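/- **Setting.** Let $d\ge 1$, $L>0$, let $N\ge 2$ be even, $\rho=N/L^d$, $0\neq \mathbf j_*\in\mathbb Z^d$ and $\phi>0$. Put $k_{\mathbf j}=\frac{2\pi}{L}\mathbf j$ and let $a_{\mathbf j},a^*_{\mathbf j}$ be the bosonic annihilation and creation operators of the plane-wave modes on the torus of side $L$. On the $N$-particle sector $\mathcal F^N$ of the Fock space consider the three-modes Bogoliubov Hamiltonian $$H=\sum_{\mathbf j\ne\pm\mathbf j_*}k_{\mathbf j}^2a^*_{\mathbf j}a_{\mathbf j}+\sum_{\mathbf j=\pm\mathbf j_*}\Big(k_{\mathbf j}^2+\phi\,\tfrac{a_{\mathbf 0}^*a_{\mathbf 0}}{N}\Big)a^*_{\mathbf j}a_{\mathbf j}+W+W^*,\qquad W=\phi\,\frac{a^*_{\mathbf 0}a^*_{\mathbf 0}a_{\mathbf j_*}a_{-\mathbf j_*}}{N}.$$ Put $\epsilon=k_{\mathbf j_*}^2/\phi$, $E^{Bog}_{\mathbf j_*}=-\big[k_{\mathbf j_*}^2+\phi-\sqrt{(k_{\mathbf j_*}^2)^2+2\phi k_{\mathbf j_*}^2}\,\big]$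 and $z_{\max}=E^{Bog}_{\mathbf j_*}+\sqrt\epsilon\,\phi\sqrt{\epsilon^2+2\epsilon}$. For even $i$ with $0\le i\le N-2$ let $Q_i$ be the orthogonal projection onto the vectors with $N-i$ or $N-i-1$ particles in the modes $\pm\mathbf j_*$, and for $z\in\mathbb R$ let $R_i(z)=Q_i\,(Q_i(H-z)Q_i)^{-1}Q_i$, $\Gamma_0(z)=0$ and $$\Gamma_{i+2}(z)=Q_{i+2}WQ_i\,R_i(z)\sum_{l\ge0}[\Gamma_i(z)R_i(z)]^l\,Q_iW^*Q_{i+2}.$$ With $\eta$ the normalized state having all $N$ particles in the zero mode, let $$f(z)=-z-\Big\langle\eta,\;W R_{N-2}(z)\sum_{l\ge0}[\Gamma_{N-2}(z)R_{N-2}(z)]^l\,W^*\eta\Big\rangle .$$ The function $f$ is called well defined at $z$ if all the $R_i(z)$ exist as bounded operators and all the series $\sum_l[\Gamma_i(z)R_i(z)]^l$, $0\le i\le N-2$, converge in operator norm. For $0<\gamma<1$ and $k_\gamma>0$ consider the condition $$(\ast)\qquad \epsilon^2+\frac{\epsilon}{N^\gamma}+\frac1N\le k_\gamma\,\epsilon\sqrt\epsilon,\qquad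 \frac1{N^{1-\gamma}}\le k_\gamma\,\epsilon .$$ **Statement.** 1. There are absolute constants $c,C>0$ such that for every $\gamma\in(0,1)$ there are $\epsilon_0,k_\gamma>0$ (depending only on $\gamma$) with the following properties. If $\epsilon\le\epsilon_0$ and $(\ast)$ holds, then $f$ is well defined on $(-\infty,z_{\max}]$ and has exactly one zero $z_*$ there. Moreover, for every $\beta\in(0,1)$ there is $\tau>0$ (depending only on $\gamma,\beta$) such that, if in addition $\frac1{N^\beta}\le\tau\epsilon$ and $\frac1{N^{1-\beta}}\le\tau\sqrt\epsilon$ (in particular, eventually in every regime in which $\frac1{N^\beta}=o(\epsilon)$ and $\frac1{N^{1-\beta}}=o(\sqrt\epsilon)$), then $$|z_*-E^{Bog}_{\mathbf j_*}|\le C\,\phi\left(\frac1{\epsilon N^\beta}+\frac1{\sqrt\epsilon}\Big[\frac1{1+c\sqrt\epsilon}\Big]^{N^{1-\beta}}+\frac1N\right).$$ 2. (Mean-field limit.) There is an absolute constant $\epsilon_0>0$ such that, if $d,L,\mathbf j_*,\phi$ are fixed with $\epsilon\le\epsilon_0$ and $N\to\infty$ along even integers, then eventually $f$ is well defined on $(-\infty,z_{\max}]$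 and has exactly one zero $z_*$ there, and $z_*\to E^{Bog}_{\mathbf j_*}$. 3. (Fixed density.) If $d\ge4$ and $\rho,\mathbf j_*,\phi$ are fixed, and $L\to\infty$ with $N=\rho L^d$ an even integer, then eventually $f$ is well defined on $(-\infty,z_{\max}]$ and has exactly one zero $z_*$ there, and $z_*-E^{Bog}_{\mathbf j_*}\to0$. -/

import Mathlib

open Filter Topology

noncomputable section

namespace BogoliubovThreeModes

/-- Mode labels: the lattice of integer vectors of length `d`; the label `k` stands for the plane wave
with wave vector `(2π / L) k` on the torus of side `L`. -/
abbrev Mode (d : ℕ) : Type := Fin d → ℤ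

/-- Occupation-number configurations with `N` particles in total. -/
abbrev Occ (d N : ℕ) : Type := {n : Mode d →₀ ℕ // n.degree = N}

/-- The `N`-particle sector of the bosonic Fock space over the square-integrable functions on the
torus, in the occupation-number representation with respect to the plane waves:
`ψ n` is the coefficient of `ψ` along the normalized product state with occupation numbers `n`. -/
abbrev FockN (d N : ℕ) : Type := lp (fun _ : Occ d N => ℂ) 2

variable {d : ℕ}

/-- The coefficient of `ψ` at an arbitrary configuration (zero unless it has `N` particles). -/
def amp {N : ℕ} (ψ : FockN d N) (n : Mode d →₀ ℕ) : ℂ :=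
  if h : n.degree = N then ψ ⟨n, h⟩ else 0

theorem amp_add {N : ℕ} (ψ χ : FockN d N) (n : Mode d →₀ ℕ) :
    amp (ψ + χ) n = amp ψ n + amp χ n := by
  by_cases h : n.degree = N <;> simp [amp, h]

theorem amp_smul {N : ℕ} (c : ℂ) (ψ : FockN d N) (n : Mode d →₀ ℕ) :
    amp (c • ψ) n = c * amp ψ n := by
  by_cases h : n.degree = N <;> simp [amp, h]

/-- `(a_k ψ)(n) = √(n_k + 1) ψ(n + δ_k)`. -/
def annihFun {N : ℕ} (k : Mode d) (ψ : FockN d N) (n : Occ d (N - 1)) : ℂ :=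
  (Real.sqrt ((n.1 k : ℝ) + 1) : ℂ) * amp ψ (n.1 + Finsupp.single k 1)

theorem annihFun_finset {N : ℕ} (k : Mode d) (ψ : FockN d N) (s : Finset (Occ d (N - 1))) :
    ∑ n ∈ s, ‖annihFun k ψ n‖ ^ 2 ≤ (N : ℝ) * ‖ψ‖ ^ 2 := by
  classical
  rcases Nat.eq_zero_or_pos N with hN | hN
  · have h0 : ∀ n : Occ d (N - 1), annihFun k ψ n = 0 := by
      intro n
      have : (n.1 + Finsupp.single k 1).degree ≠ N := by
        rw [map_add, Finsupp.degree_single]; omega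
      rw [annihFun, amp, dif_neg this, mul_zero]
    simp only [h0, norm_zero]
    simp only [ne_eq, OfNat.ofNat_ne_zero, not_false_eq_true, zero_pow, Finset.sum_const_zero]
    positivity
  · have hdeg : ∀ n : Occ d (N - 1), (n.1 + Finsupp.single k 1).degree = N := by
      intro n
      rw [map_add, Finsupp.degree_single, n.2]; omega
    let g : Occ d (N - 1) → Occ d N := fun n => ⟨n.1 + Finsupp.single k 1, hdeg n⟩
    have hg : Function.Injective g := by
      intro a b hab
      have h1 : a.1 + Finsupp.single k 1 = b.1 + Finsupp.single k 1 := congrArg Subtype.val hab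
      exact Subtype.ext (add_right_cancel h1)
    have hterm : ∀ n : Occ d (N - 1), ‖annihFun k ψ n‖ ^ 2 ≤ (N : ℝ) * ‖ψ (g n)‖ ^ 2 := by
      intro n
      have hk : (n.1 k : ℝ) + 1 ≤ N := by
        have h1 : n.1 k ≤ n.1.degree := Finsupp.le_degree k n.1
        have h2 := n.2
        have h3 : n.1 k + 1 ≤ N := by omega
        exact_mod_cast h3
      have h0 : (0 : ℝ) ≤ (n.1 k : ℝ) + 1 := by positivity
      have hamp : amp ψ (n.1 + Finsupp.single k 1) = ψ (g n) := by
        simp only [amp, hdeg n, dite_true, g]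
      rw [annihFun, hamp, norm_mul, mul_pow, Complex.norm_real, Real.norm_eq_abs, sq_abs,
        Real.sq_sqrt h0]
      exact mul_le_mul_of_nonneg_right hk (by positivity)
    have hsum : ∑ m ∈ s.image g, ‖ψ m‖ ^ 2 ≤ ‖ψ‖ ^ 2 := by
      have h := lp.sum_rpow_le_norm_rpow (p := 2) (by norm_num) ψ (s.image g)
      simpa using h
    calc ∑ n ∈ s, ‖annihFun k ψ n‖ ^ 2 ≤ ∑ n ∈ s, (N : ℝ) * ‖ψ (g n)‖ ^ 2 :=
          Finset.sum_le_sum fun n _ => hterm n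
      _ = (N : ℝ) * ∑ m ∈ s.image g, ‖ψ m‖ ^ 2 := by
          rw [← Finset.mul_sum, Finset.sum_image fun a _ b _ h => hg h]
      _ ≤ (N : ℝ) * ‖ψ‖ ^ 2 := mul_le_mul_of_nonneg_left hsum (by positivity)

theorem annihFun_memlp {N : ℕ} (k : Mode d) (ψ : FockN d N) :
    Memℓp (E := fun _ : Occ d (N - 1) => ℂ) (annihFun k ψ) 2 := by
  refine memℓp_gen' (C := (N : ℝ) * ‖ψ‖ ^ 2) fun s => ?_
  simpa using annihFun_finset k ψ s

/-- The annihilation operator `a_k` from the `N`-particle to the `(N - 1)`-particle sector (for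
`N = 0` it is the zero operator). -/
def annih (N : ℕ) (k : Mode d) : FockN d N →L[ℂ] FockN d (N - 1) :=
  LinearMap.mkContinuous
    { toFun := fun ψ => ⟨annihFun k ψ, annihFun_memlp k ψ⟩
      map_add' := by
        intro ψ χ
        ext n
        change annihFun k (ψ + χ) n = annihFun k ψ n + annihFun k χ n
        rw [annihFun, amp_add, mul_add, annihFun, annihFun]
      map_smul' := by
        intro c ψ
        ext n
        change annihFun k (c • ψ) n = c * annihFun k ψ n
        rw [annihFun, amp_smul, mul_left_comm, annihFun] }
    (Real.sqrt N)
    (by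
      intro ψ
      refine lp.norm_le_of_forall_sum_le (p := 2) (by norm_num) (by positivity) fun s => ?_
      have h := annihFun_finset k ψ s
      have e : (Real.sqrt N * ‖ψ‖) ^ 2 = (N : ℝ) * ‖ψ‖ ^ 2 := by
        rw [mul_pow, Real.sq_sqrt (by positivity)]
      simpa [e] using h)

/-- The creation operator `a_k^*`, the adjoint of `a_k`. -/
def creat (N : ℕ) (k : Mode d) : FockN d (N - 1) →L[ℂ] FockN d N :=
  ContinuousLinearMap.adjoint (annih N k)

/-- The number operator `a_k^* a_k` on the `N`-particle sector. -/
def num (N : ℕ) (k : Mode d) : FockN d N →L[ℂ] FockN d N := creat N k ∘L annih N k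

/-- `R` is the inverse of the compression `Q (H - z) Q` on the range of `Q`, extended by zero to the
orthogonal complement. -/
def IsCompressedResolvent {E : Type*} [NormedAddCommGroup E] [InnerProductSpace ℂ E]
    (H : E →ₗ.[ℂ] E) (Q : E →L[ℂ] E) (z : ℝ) (R : E →L[ℂ] E) : Prop :=
  Q ∘L R = R ∧ R ∘L Q = R ∧
  (∀ ψ : E, ∃ h : R ψ ∈ H.domain, Q (H ⟨R ψ, h⟩ - (z : ℂ) • R ψ) = Q ψ) ∧
  (∀ ψ : H.domain, Q (ψ : E) = ψ → R (Q (H ψ - (z : ℂ) • (ψ : E))) = ψ)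

open Classical in
/-- The operator `Q (Q (H - z) Q)⁻¹ Q` (zero if the compression is not boundedly invertible). -/
def compressedResolvent {E : Type*} [NormedAddCommGroup E] [InnerProductSpace ℂ E]
    (H : E →ₗ.[ℂ] E) (Q : E →L[ℂ] E) (z : ℝ) : E →L[ℂ] E :=
  if h : ∃ R, IsCompressedResolvent H Q z R then h.choose else 0

end BogoliubovThreeModes

open BogoliubovThreeModes

/-- The data of the three-modes system: `N` (even) bosons in a periodic box of side `L` in dimension
`d`, interacting through a pair potential whose only nonzero Fourier components (apart from the zero
mode, which plays no role) are `φ_j = φ_{-j} = φ > 0` for the nonzero mode label `j`. -/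
structure ThreeModeSystem (d : ℕ) where
  L : ℝ
  N : ℕ
  j : Mode d
  φ : ℝ
  L_pos : 0 < L
  N_pos : 0 < N
  N_even : Even N
  j_ne : j ≠ 0
  φ_pos : 0 < φ

namespace ThreeModeSystem

variable {d : ℕ} (S : ThreeModeSystem d)

/-- The kinetic energy `|k|² = |(2π / L) k|²` of a mode (units `ħ = 1`, `m = 1/2`). -/
def kin (k : Mode d) : ℝ := ∑ i, (2 * Real.pi / S.L * (k i : ℝ)) ^ 2

/-- The ratio `ε` between the kinetic energy of the interacting modes and the potential. -/
def eps : ℝ := S.kin S.j / S.φ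

/-- The Bogoliubov energy. -/
def EBog : ℝ :=
  -(S.kin S.j + S.φ - Real.sqrt (S.kin S.j ^ 2 + 2 * S.φ * S.kin S.j))

/-- The upper end `E^Bog + √ε φ √(ε² + 2 ε)` of the range of the spectral parameter. -/
def zMax : ℝ :=
  S.EBog + Real.sqrt S.eps * S.φ * Real.sqrt (S.eps ^ 2 + 2 * S.eps)

/-- The particle density. -/
def density : ℝ := S.N / S.L ^ d

/-- The Hilbert space of the system. -/
abbrev Space : Type := FockN d S.N

/-- The interaction term `W = φ a_0^* a_0^* a_j a_{-j} / N`. -/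
def W : S.Space →L[ℂ] S.Space :=
  ((S.φ / S.N : ℝ) : ℂ) •
    (creat S.N 0 ∘L creat (S.N - 1) 0 ∘L annih (S.N - 1) S.j ∘L annih S.N (-S.j))

/-- The interaction term `W^* = φ a_j^* a_{-j}^* a_0 a_0 / N`. -/
def Wstar : S.Space →L[ℂ] S.Space :=
  ((S.φ / S.N : ℝ) : ℂ) •
    (creat S.N S.j ∘L creat (S.N - 1) (-S.j) ∘L annih (S.N - 1) 0 ∘L annih S.N 0)

/-- `Ĥ⁰ = ∑_{±} (k_j² + φ a_0^* a_0 / N) a_{±j}^* a_{±j}`. -/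
def H0hat : S.Space →L[ℂ] S.Space :=
  ((S.kin S.j : ℂ) • ContinuousLinearMap.id ℂ S.Space + ((S.φ / S.N : ℝ) : ℂ) • num S.N 0) ∘L
    (num S.N S.j + num S.N (-S.j))

/-- The kinetic energy of a configuration in the modes other than `j` and `-j`. -/
def kinRest (n : Occ d S.N) : ℝ :=
  ∑ k ∈ n.1.support \ {S.j, -S.j}, S.kin k * (n.1 k : ℝ)

/-- The kinetic energy operator `∑_{k ≠ ±j} k² a_k^* a_k`, with its maximal domain. -/
def kineticRest : S.Space →ₗ.[ℂ] S.Space where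
  domain :=
    { carrier := {ψ | Memℓp (E := fun _ : Occ d S.N => ℂ)
        (fun n => (S.kinRest n : ℂ) * ψ n) 2}
      add_mem' := by
        intro ψ χ hψ hχ
        have h := Memℓp.add hψ hχ
        have e : (fun n => (S.kinRest n : ℂ) * (ψ + χ) n) =
            (fun n => (S.kinRest n : ℂ) * ψ n) + fun n => (S.kinRest n : ℂ) * χ n := by
          funext n
          simp [mul_add]
        simpa only [Set.mem_ofPred_eq, e] using h
      zero_mem' := by
        have e : (fun n => (S.kinRest n : ℂ) * (0 : S.Space) n) = 0 := by
          funext n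
          simp
        simpa only [Set.mem_ofPred_eq, e] using
          (zero_memℓp : Memℓp (0 : ∀ _ : Occ d S.N, ℂ) 2)
      smul_mem' := by
        intro c ψ hψ
        have h := Memℓp.const_smul hψ c
        have e : (fun n => (S.kinRest n : ℂ) * (c • ψ) n) =
            c • fun n => (S.kinRest n : ℂ) * ψ n := by
          funext n
          simp [mul_left_comm]
        simpa only [Set.mem_ofPred_eq, e] using h }
  toFun :=
    { toFun := fun ψ => ⟨fun n => (S.kinRest n : ℂ) * (ψ : S.Space) n, ψ.2⟩
      map_add' := by
        intro ψ χ
        ext n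
        exact mul_add (S.kinRest n : ℂ) ((ψ : S.Space) n) ((χ : S.Space) n)
      map_smul' := by
        intro c ψ
        ext n
        exact mul_left_comm (S.kinRest n : ℂ) c ((ψ : S.Space) n) }

/-- The Bogoliubov Hamiltonian `H^Bog_j = ∑_{k ≠ ±j} k² a_k^* a_k + Ĥ⁰ + W + W^*` of the three-modes
system on the `N`-particle sector. -/
def HBog : S.Space →ₗ.[ℂ] S.Space where
  domain := S.kineticRest.domain
  toFun := S.kineticRest.toFun +
    ((S.H0hat + S.W + S.Wstar).toLinearMap ∘ₗ S.kineticRest.domain.subtype)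

/-- The closed subspace of vectors with exactly `N - i` or `N - i - 1` particles in the modes
`±j`. -/
def sector (i : ℕ) : Submodule ℂ S.Space where
  carrier := {ψ | ∀ n : Occ d S.N,
    n.1 S.j + n.1 (-S.j) + i ≠ S.N → n.1 S.j + n.1 (-S.j) + i + 1 ≠ S.N → ψ n = 0}
  add_mem' := by
    intro ψ χ hψ hχ n h1 h2
    simp [hψ n h1 h2, hχ n h1 h2]
  zero_mem' := by
    intro n _ _
    simp
  smul_mem' := by
    intro c ψ hψ n h1 h2
    simp [hψ n h1 h2]

theorem sector_isClosed (i : ℕ) : IsClosed (S.sector i : Set S.Space) := by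
  have e : (S.sector i : Set S.Space) = ⋂ n : Occ d S.N, {ψ : S.Space |
      n.1 S.j + n.1 (-S.j) + i ≠ S.N → n.1 S.j + n.1 (-S.j) + i + 1 ≠ S.N → ψ n = 0} := by
    ext ψ
    simp [sector]
  rw [e]
  refine isClosed_iInter fun n => ?_
  by_cases h1 : n.1 S.j + n.1 (-S.j) + i ≠ S.N
  · by_cases h2 : n.1 S.j + n.1 (-S.j) + i + 1 ≠ S.N
    · simp only [h1, h2, ne_eq, not_false_eq_true, forall_const]
      exact isClosed_eq (lp.evalCLM ℂ (fun _ : Occ d S.N => ℂ) 2 n).continuous continuous_const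
    · simp [h2]
  · simp [h1]

instance sector_hasOrthogonalProjection (i : ℕ) : (S.sector i).HasOrthogonalProjection :=
  haveI : CompleteSpace (S.sector i) := (S.sector_isClosed i).completeSpace_coe
  inferInstance

/-- The orthogonal projection `Q^{(i,i+1)}`. -/
def Q (i : ℕ) : S.Space →L[ℂ] S.Space := (S.sector i).starProjection

/-- `R_{i,i}(z) = Q^{(i,i+1)} (Q^{(i,i+1)} (H^Bog - z) Q^{(i,i+1)})⁻¹ Q^{(i,i+1)}`. -/
def R (i : ℕ) (z : ℝ) : S.Space →L[ℂ] S.Space := compressedResolvent S.HBog (S.Q i) z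

/-- The effective interaction of the Feshbach-Schur flow: `Gam z m` is `Γ_{i,i}(z)` for `i = 2 m`,
given by `Γ_{0,0} = 0` and
`Γ_{i+2,i+2} = W_{i+2,i} R_{i,i} (∑_l [Γ_{i,i} R_{i,i}]^l) W^*_{i,i+2}`, where
`W_{i+2,i} = Q^{(i+2,i+3)} W Q^{(i,i+1)}` and `W^*_{i,i+2} = Q^{(i,i+1)} W^* Q^{(i+2,i+3)}`.
The series is a sum in operator norm. -/
def Gam (z : ℝ) : ℕ → (S.Space →L[ℂ] S.Space)
  | 0 => 0
  | m + 1 =>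
    (S.Q (2 * m + 2) * S.W * S.Q (2 * m)) * S.R (2 * m) z *
      (∑' l : ℕ, (Gam z m * S.R (2 * m) z) ^ l) *
      (S.Q (2 * m) * S.Wstar * S.Q (2 * m + 2))

/-- All steps `i = 0, 2, …, N - 2` of the flow are well defined at `z`: the compressed resolvents
exist and the Neumann series converge in operator norm. -/
def FlowDefined (z : ℝ) : Prop :=
  ∀ i : ℕ, Even i → i + 2 ≤ S.N →
    (∃ T, IsCompressedResolvent S.HBog (S.Q i) z T) ∧
    Summable fun l : ℕ => (S.Gam z (i / 2) * S.R i z) ^ l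

open Classical in
/-- The state `η` with all `N` particles in the zero mode. -/
def eta : S.Space :=
  lp.single 2 (⟨Finsupp.single 0 S.N, Finsupp.degree_single 0 S.N⟩ : Occ d S.N) (1 : ℂ)

/-- The function `f(z) = -z - ⟨η, W R_{N-2,N-2}(z) ∑_l [Γ_{N-2,N-2}(z) R_{N-2,N-2}(z)]^l W^* η⟩`
(the inner product is real; the last Feshbach-Schur Hamiltonian is `f(z) |η⟩⟨η|`). -/
def f (z : ℝ) : ℝ :=
  -z - (inner ℂ S.eta
    ((S.W * S.R (S.N - 2) z *
      (∑' l : ℕ, (S.Gam z ((S.N - 2) / 2) * S.R (S.N - 2) z) ^ l) * S.Wstar) S.eta)).re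

/-- `z` is a zero of `f` in the admissible range. -/
def IsFixedPoint (z : ℝ) : Prop := z ≤ S.zMax ∧ S.f z = 0

/-- The point `z_*`: the zero of `f` in the admissible range (meaningful when it is unique). -/
def zStar : ℝ := Classical.epsilon S.IsFixedPoint

/-- `f` is well defined on the admissible range and has exactly one zero there. -/
def HasFixedPoint : Prop :=
  (∀ z : ℝ, z ≤ S.zMax → S.FlowDefined z) ∧ ∃! z : ℝ, S.IsFixedPoint z

/-- The smallness condition on `ε` and `1 / N` with parameters `γ` and `κ`. -/
def GammaCondition (γ κ : ℝ) : Prop :=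
  S.eps ^ 2 + S.eps / (S.N : ℝ) ^ γ + 1 / (S.N : ℝ) ≤ κ * (S.eps * Real.sqrt S.eps) ∧
  1 / (S.N : ℝ) ^ (1 - γ) ≤ κ * S.eps

end ThreeModeSystem

end

/-!
In the occupation basis `W` moves a pair of particles from the modes `±j` into the zero mode, and
everything else in the Hamiltonian is diagonal. Hence every `R_i(z)` and `Γ_i(z)` is diagonal, and
the Feshbach-Schur flow is a scalar continued fraction `schur z n = D n - z - c n ^ 2 / schur z n'`,
where `D n` is the diagonal energy of the configuration `n`, `n'` has one more pair in the modes
`±j`, and `c n` is the matrix element of `W` between the two; `f z` is its value at the condensate.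

For a constant ratio `n 0 / N` the recursion has linear solutions in the number `p` of pairs, of
slope `φ (1 + ε ± b)` with `b ^ 2 = ε ^ 2 + 2 ε`. Correcting them for the depletion of the zero mode
gives a supersolution `φ (n 0 + 1) / N * (p - σ) (1 + ε + b)`: with `σ = √ε` it keeps the
denominators positive for all `z ≤ zMax`, and with `σ = 0` it shows `f ≥ 0` at the Bogoliubov
energy. A subsolution, of slope larger by the factor `1 + 3 / (N b)`, shows `f ≤ 0` at a point of
distance `O(φ / (N √ε))` above it. As `f` is continuous and strictly decreasing, its only zero lies
in between.
-/

namespace BogoliubovThreeModes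

section CompressedResolvent

variable {E : Type*} [NormedAddCommGroup E] [InnerProductSpace ℂ E] {H : E →ₗ.[ℂ] E}
  {Q R R' : E →L[ℂ] E} {z : ℝ}

theorem IsCompressedResolvent.unique (hR : IsCompressedResolvent H Q z R)
    (hR' : IsCompressedResolvent H Q z R') : R = R' := by
  obtain ⟨-, hRQ, -, hleft⟩ := hR
  obtain ⟨hQR', -, hright, -⟩ := hR'
  ext1 ψ
  obtain ⟨hdom, hψ⟩ := hright ψ
  have hR'ψ : R (Q (H ⟨R' ψ, hdom⟩ - (z : ℂ) • R' ψ)) = R' ψ :=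
    hleft ⟨R' ψ, hdom⟩ (DFunLike.congr_fun hQR' ψ)
  calc R ψ = R (Q ψ) := (DFunLike.congr_fun hRQ ψ).symm
    _ = R' ψ := by rw [← hψ, hR'ψ]

theorem IsCompressedResolvent.compressedResolvent_eq (hR : IsCompressedResolvent H Q z R) :
    compressedResolvent H Q z = R := by
  have hex : ∃ R, IsCompressedResolvent H Q z R := ⟨R, hR⟩
  rw [compressedResolvent, dif_pos hex]
  exact hex.choose_spec.unique hR

end CompressedResolvent

section Diagonal

open scoped ENNReal

variable {ι 𝕜 : Type*} [RCLike 𝕜] {p : ℝ≥0∞} [Fact (1 ≤ p)]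

/-- `T` multiplies the `i`-th coordinate by the real number `g i`: it is diagonal in the standard
basis of `ℓᵖ`, with symbol `g`. -/
def IsDiagonal (T : lp (fun _ : ι => 𝕜) p →L[𝕜] lp (fun _ : ι => 𝕜) p) (g : ι → ℝ) : Prop :=
  ∀ ψ i, T ψ i = (g i : 𝕜) * ψ i

theorem exists_isDiagonal {g : ι → ℝ} {C : ℝ} (hC : 0 ≤ C) (hg : ∀ i, |g i| ≤ C) :
    ∃ T : lp (fun _ : ι => 𝕜) p →L[𝕜] lp (fun _ : ι => 𝕜) p, IsDiagonal T g ∧ ‖T‖ ≤ C := by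
  have hnorm : ∀ i, ‖ContinuousLinearMap.toSpanSingleton 𝕜 (g i : 𝕜)‖ ≤ C := by simpa using hg
  exact ⟨lp.mapCLM p _ hC hnorm, fun ψ i => by simp [mul_comm], lp.norm_mapCLM_le p _ hC hnorm⟩

namespace IsDiagonal

variable {T U : lp (fun _ : ι => 𝕜) p →L[𝕜] lp (fun _ : ι => 𝕜) p} {g g' : ι → ℝ}

theorem congr (hT : IsDiagonal T g) (h : ∀ i, g i = g' i) : IsDiagonal T g' :=
  funext h ▸ hT

theorem zero : IsDiagonal (0 : lp (fun _ : ι => 𝕜) p →L[𝕜] lp (fun _ : ι => 𝕜) p) 0 :=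
  fun ψ i => by simp

theorem mul (hT : IsDiagonal T g) (hU : IsDiagonal U g') : IsDiagonal (T * U) (g * g') := by
  intro ψ i
  rw [mul_apply_eq_comp, hT, hU, Pi.mul_apply, RCLike.ofReal_mul, mul_assoc]

theorem ext (hT : IsDiagonal T g) (hU : IsDiagonal U g) : T = U := by
  ext ψ i
  rw [hT, hU]

theorem norm_le (hT : IsDiagonal T g) {C : ℝ} (hC : 0 ≤ C) (hg : ∀ i, |g i| ≤ C) : ‖T‖ ≤ C := by
  obtain ⟨U, hU, hnorm⟩ := exists_isDiagonal (𝕜 := 𝕜) (p := p) hC hg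
  exact hT.ext hU ▸ hnorm

theorem abs_apply_le_norm (hT : IsDiagonal T g) (i : ι) : |g i| ≤ ‖T‖ := by
  classical
  have hp : 0 < p := zero_lt_one.trans_le Fact.out
  calc |g i| = ‖T (lp.single p i 1) i‖ := by simp [hT _ i]
    _ ≤ ‖T (lp.single p i 1)‖ := lp.norm_apply_le_norm hp.ne' _ i
    _ ≤ ‖T‖ := by simpa [lp.norm_single hp] using T.le_opNorm (lp.single p i 1)

theorem tsum_pow (hT : IsDiagonal T g) (hlt : ‖T‖ < 1) :
    IsDiagonal (∑' l : ℕ, T ^ l) (1 - g)⁻¹ := by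
  intro ψ i
  have hne : ((1 - g i : ℝ) : 𝕜) ≠ 0 := by
    have := (le_abs_self _).trans_lt ((hT.abs_apply_le_norm i).trans_lt hlt)
    exact_mod_cast (sub_pos.2 this).ne'
  have hgeom : ((1 - T) * ∑' l : ℕ, T ^ l) ψ i = ψ i := by
    rw [mul_neg_geom_series T hlt, one_apply_eq_self]
  have hmul : ((1 - g i : ℝ) : 𝕜) * (∑' l : ℕ, T ^ l) ψ i = ψ i := by
    rw [← hgeom, mul_apply_eq_comp, sub_apply, lp.coeFn_sub,
      Pi.sub_apply, hT, one_apply_eq_self]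
    push_cast
    ring
  rw [← hmul, Pi.inv_apply, Pi.sub_apply, Pi.one_apply, RCLike.ofReal_inv, inv_mul_cancel_left₀ hne]

end IsDiagonal

end Diagonal

section Hilbert

variable {ι 𝕜 : Type*} [RCLike 𝕜]

theorem isDiagonal_starProjection {K : Submodule 𝕜 (lp (fun _ : ι => 𝕜) 2)}
    [K.HasOrthogonalProjection] {s : Set ι} (hK : ∀ ψ, ψ ∈ K ↔ ∀ i ∉ s, ψ i = 0) :
    IsDiagonal K.starProjection (s.indicator 1) := by
  classical
  obtain ⟨P, hP, -⟩ := exists_isDiagonal (𝕜 := 𝕜) (p := 2) (g := s.indicator 1) zero_le_one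
    fun i => by by_cases hi : i ∈ s <;> simp [hi]
  suffices h : K.starProjection = P from h ▸ hP
  ext1 ψ
  refine Submodule.eq_starProjection_of_mem_of_inner_eq_zero ((hK _).2 fun i hi => ?_)
    fun χ hχ => ?_
  · simp [hP ψ i, hi]
  · rw [lp.inner_eq_tsum]
    refine (tsum_congr fun i => ?_).trans tsum_zero
    by_cases hi : i ∈ s
    · simp [hP ψ i, hi]
    · simp [(hK χ).1 hχ i hi]

section Resolvent

variable {H : lp (fun _ : ι => ℂ) 2 →ₗ.[ℂ] lp (fun _ : ι => ℂ) 2}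
  {K : Submodule ℂ (lp (fun _ : ι => ℂ) 2)} [K.HasOrthogonalProjection] {s : Set ι} {h : ι → ℝ}
  {z : ℝ}

theorem IsDiagonal.isCompressedResolvent
    {R : lp (fun _ : ι => ℂ) 2 →L[ℂ] lp (fun _ : ι => ℂ) 2}
    (hR : IsDiagonal R (s.indicator fun i => (h i - z)⁻¹)) (hK : ∀ ψ, ψ ∈ K ↔ ∀ i ∉ s, ψ i = 0)
    (hdom : ∀ ψ ∈ K, Memℓp (E := fun _ : ι => ℂ) (fun i => (h i : ℂ) * ψ i) 2 → ψ ∈ H.domain)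
    (hH : ∀ ψ : H.domain, (ψ : lp (fun _ : ι => ℂ) 2) ∈ K → ∀ i ∈ s,
      H ψ i = (h i : ℂ) * (ψ : lp (fun _ : ι => ℂ) 2) i)
    (hz : ∀ i ∈ s, h i ≠ z) : IsCompressedResolvent H K.starProjection z R := by
  have hne (i) (hi : i ∈ s) : (h i - z : ℂ) ≠ 0 := by exact_mod_cast sub_ne_zero.2 (hz i hi)
  have hQ := isDiagonal_starProjection hK
  have hQ_on (ψ) (i) (hi : i ∈ s) : K.starProjection ψ i = ψ i := by simp [hQ ψ i, hi]
  have hQ_off (ψ) (i) (hi : i ∉ s) : K.starProjection ψ i = 0 := by simp [hQ ψ i, hi]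
  have hR_on (ψ) (i) (hi : i ∈ s) : (h i - z : ℂ) * R ψ i = ψ i := by
    simp [hR ψ i, hi, mul_inv_cancel_left₀ (hne i hi)]
  have hR_off (ψ) (i) (hi : i ∉ s) : R ψ i = 0 := by simp [hR ψ i, hi]
  have hRmem (ψ) : R ψ ∈ K := (hK _).2 (hR_off ψ)
  have hsub (ψ : H.domain) (hψ : (ψ : lp (fun _ : ι => ℂ) 2) ∈ K) (i) (hi : i ∈ s) :
      (H ψ - (z : ℂ) • (ψ : lp (fun _ : ι => ℂ) 2)) i =
        (h i - z) * (ψ : lp (fun _ : ι => ℂ) 2) i := by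
    rw [lp.coeFn_sub, Pi.sub_apply, hH ψ hψ i hi, lp.coeFn_smul, Pi.smul_apply, smul_eq_mul,
      sub_mul]
  have hmul (ψ) (i) : (h i : ℂ) * R ψ i = (K.starProjection ψ + (z : ℂ) • R ψ) i := by
    rw [lp.coeFn_add, Pi.add_apply, lp.coeFn_smul, Pi.smul_apply, smul_eq_mul]
    by_cases hi : i ∈ s
    · rw [hQ_on ψ i hi]
      linear_combination hR_on ψ i hi
    · simp [hQ_off ψ i hi, hR_off ψ i hi]
  have hRdom (ψ) : R ψ ∈ H.domain :=
    hdom _ (hRmem ψ) (by simpa only [hmul] using lp.memℓp (K.starProjection ψ + (z : ℂ) • R ψ))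
  refine ⟨?_, ?_, fun ψ => ⟨hRdom ψ, ?_⟩, fun ψ hψ => ?_⟩
  · exact ContinuousLinearMap.ext fun ψ => K.starProjection_eq_self_iff.2 (hRmem ψ)
  · exact (hR.mul hQ).ext (hR.congr fun i => by by_cases hi : i ∈ s <;> simp [hi])
  · ext i
    by_cases hi : i ∈ s
    · rw [hQ_on _ i hi, hQ_on _ i hi, hsub ⟨R ψ, hRdom ψ⟩ (hRmem ψ) i hi, hR_on ψ i hi]
    · rw [hQ_off _ i hi, hQ_off _ i hi]
  · have hψK := K.starProjection_eq_self_iff.1 hψ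
    ext i
    by_cases hi : i ∈ s
    · exact mul_left_cancel₀ (hne i hi) (by rw [hR_on _ i hi, hQ_on _ i hi, hsub ψ hψK i hi])
    · rw [hR_off _ i hi, (hK _).1 hψK i hi]

theorem exists_isCompressedResolvent_isDiagonal {δ : ℝ} (hK : ∀ ψ, ψ ∈ K ↔ ∀ i ∉ s, ψ i = 0)
    (hdom : ∀ ψ ∈ K, Memℓp (E := fun _ : ι => ℂ) (fun i => (h i : ℂ) * ψ i) 2 → ψ ∈ H.domain)
    (hH : ∀ ψ : H.domain, (ψ : lp (fun _ : ι => ℂ) 2) ∈ K → ∀ i ∈ s,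
      H ψ i = (h i : ℂ) * (ψ : lp (fun _ : ι => ℂ) 2) i)
    (hδ : 0 < δ) (hgap : ∀ i ∈ s, δ ≤ h i - z) :
    ∃ R, IsCompressedResolvent H K.starProjection z R ∧
      IsDiagonal R (s.indicator fun i => (h i - z)⁻¹) := by
  have hpos (i) (hi : i ∈ s) : 0 < h i - z := hδ.trans_le (hgap i hi)
  obtain ⟨R, hR, -⟩ := exists_isDiagonal (𝕜 := ℂ) (p := 2)
    (g := s.indicator fun i => (h i - z)⁻¹) (inv_nonneg.2 hδ.le) fun i => by
      by_cases hi : i ∈ s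
      · simpa [hi, abs_of_pos (hpos i hi)] using inv_anti₀ hδ (hgap i hi)
      · simpa [hi] using hδ.le
  exact ⟨R, hR.isCompressedResolvent hK hdom hH fun i hi => (sub_pos.1 (hpos i hi)).ne', hR⟩

end Resolvent

end Hilbert

section Amplitudes

variable {d N : ℕ}

theorem amp_of_degree_eq (ψ : FockN d N) {n : Mode d →₀ ℕ} (hn : n.degree = N) :
    amp ψ n = ψ ⟨n, hn⟩ := dif_pos hn

theorem amp_of_degree_ne (ψ : FockN d N) {n : Mode d →₀ ℕ} (hn : n.degree ≠ N) :
    amp ψ n = 0 := dif_neg hn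

theorem amp_coe (ψ : FockN d N) (n : Occ d N) : amp ψ n.1 = ψ n := amp_of_degree_eq ψ n.2

theorem amp_annih (k : Mode d) (ψ : FockN d N) (n : Mode d →₀ ℕ) :
    amp (annih N k ψ) n = √((n k : ℝ) + 1) * amp ψ (n + Finsupp.single k 1) := by
  by_cases hn : n.degree = N - 1
  · exact amp_of_degree_eq _ hn
  · have hn' : (n + Finsupp.single k 1).degree ≠ N := by
      rw [map_add, Finsupp.degree_single]
      omega
    rw [amp_of_degree_ne _ hn, amp_of_degree_ne _ hn', mul_zero]

open Classical in
theorem amp_single (n : Occ d N) (m : Mode d →₀ ℕ) :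
    amp (lp.single 2 n (1 : ℂ) : FockN d N) m = if m = n.1 then 1 else 0 := by
  by_cases hm : m.degree = N
  · simp [amp_of_degree_eq _ hm, lp.single_apply, Pi.single_apply, Subtype.ext_iff]
  · rw [amp_of_degree_ne _ hm, if_neg (by rintro rfl; exact hm n.2)]

open Classical in
theorem amp_creat_eq_inner (k : Mode d) (χ : FockN d (N - 1)) (n : Occ d N) :
    amp (creat N k χ) n.1 = inner ℂ (annih N k (lp.single 2 n (1 : ℂ))) χ := by
  rw [← ContinuousLinearMap.adjoint_inner_right, lp.inner_single_left, amp_coe, creat]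
  simp

theorem amp_creat (hN : 0 < N) (k : Mode d) (χ : FockN d (N - 1)) (n : Mode d →₀ ℕ) :
    amp (creat N k χ) n = √(n k) * amp χ (n - Finsupp.single k 1) := by
  classical
  by_cases hk : n k = 0
  · by_cases hn : n.degree = N
    · have hann : annih N k (lp.single 2 (⟨n, hn⟩ : Occ d N) (1 : ℂ)) = 0 := by
        ext m
        have hm : m.1 + Finsupp.single k 1 ≠ n := fun h => by simp [← h] at hk
        rw [← amp_coe, amp_annih, amp_single, if_neg hm, mul_zero]
        rfl
      simp [amp_creat_eq_inner k χ ⟨n, hn⟩, hann, hk]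
    · simp [amp_of_degree_ne _ hn, hk]
  · obtain ⟨m, rfl⟩ : ∃ m, n = m + Finsupp.single k 1 :=
      ⟨_, (tsub_add_cancel_of_le (Finsupp.single_le_iff.2 (Nat.one_le_iff_ne_zero.2 hk))).symm⟩
    have hdeg : (m + Finsupp.single k 1).degree = m.degree + 1 := by simp
    rw [add_tsub_cancel_right]
    by_cases hm : m.degree = N - 1
    · have hn : (m + Finsupp.single k 1).degree = N := by omega
      have hann : annih N k (lp.single 2 (⟨_, hn⟩ : Occ d N) (1 : ℂ)) =
          (√((m k : ℝ) + 1) : ℂ) • (lp.single 2 (⟨m, hm⟩ : Occ d (N - 1)) (1 : ℂ)) := by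
        ext l
        rw [← amp_coe, ← amp_coe, amp_annih, amp_smul, amp_single, amp_single]
        by_cases hl : l.1 = m <;> simp [hl]
      rw [amp_creat_eq_inner k χ ⟨_, hn⟩, hann, inner_smul_left, lp.inner_single_left,
        amp_of_degree_eq χ hm]
      simp
    · rw [amp_of_degree_ne _ (by omega), amp_of_degree_ne _ hm, mul_zero]

theorem isDiagonal_iff_amp {T : FockN d N →L[ℂ] FockN d N} {g : (Mode d →₀ ℕ) → ℝ} :
    IsDiagonal T (fun n => g n.1) ↔ ∀ ψ n, amp (T ψ) n = g n * amp ψ n := by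
  refine ⟨fun hT ψ n => ?_, fun hT ψ n => ?_⟩
  · by_cases hn : n.degree = N
    · rw [amp_of_degree_eq _ hn, amp_of_degree_eq _ hn, hT]
      rfl
    · rw [amp_of_degree_ne _ hn, amp_of_degree_ne _ hn, mul_zero]
  · rw [← amp_coe, hT, amp_coe]
    rfl

theorem isDiagonal_num (hN : 0 < N) (k : Mode d) : IsDiagonal (num N k) fun n => n.1 k := by
  refine (isDiagonal_iff_amp (g := fun n => n k)).2 fun ψ n => ?_
  rw [num, ContinuousLinearMap.comp_apply, amp_creat hN, amp_annih]
  by_cases hk : n k = 0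
  · simp [hk]
  · have hle : Finsupp.single k 1 ≤ n := Finsupp.single_le_iff.2 (Nat.one_le_iff_ne_zero.2 hk)
    have hcast : (((n - Finsupp.single k 1 : Mode d →₀ ℕ) k : ℕ) : ℝ) + 1 = n k := by
      exact_mod_cast (by simp; omega : (n - Finsupp.single k 1 : Mode d →₀ ℕ) k + 1 = n k)
    rw [hcast, tsub_add_cancel_of_le hle, ← mul_assoc, ← Complex.ofReal_mul,
      Real.mul_self_sqrt (Nat.cast_nonneg _)]

end Amplitudes

section Scalar

variable {ε b σ p κ t N : ℝ}

theorem sq_mul_div_add_mul_le (hσ : 0 ≤ σ) (hσp : σ ≤ p) (hε : 0 ≤ ε) (hb : 0 ≤ b)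
    (hb2 : b ^ 2 = ε ^ 2 + 2 * ε) (hσε : σ ^ 2 ≤ ε) :
    (p + 1) ^ 2 * (1 + ε - b) / (p + 1 - σ) + (p - σ) * (1 + ε + b) ≤
      2 * p * (1 + ε) + (1 + ε - b) - σ * b := by
  have hεb : ε ≤ b := abs_le_of_sq_le_sq' (by linarith) hb |>.2
  have hσb : σ ≤ b := abs_le_of_sq_le_sq' (by nlinarith) hb |>.2
  have hc : 0 < 1 + ε - b := by nlinarith
  have hquot : (p + 1) ^ 2 / (p + 1 - σ) ≤ p + 1 + σ + σ ^ 2 := by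
    rw [div_le_iff₀ (by linarith)]
    nlinarith [mul_nonneg (sq_nonneg σ) (sub_nonneg.2 hσp)]
  have hσc : σ * (σ * (1 + ε - b)) ≤ σ * b := by
    gcongr
    nlinarith
  calc (p + 1) ^ 2 * (1 + ε - b) / (p + 1 - σ) + (p - σ) * (1 + ε + b)
      = (p + 1) ^ 2 / (p + 1 - σ) * (1 + ε - b) + (p - σ) * (1 + ε + b) := by ring
    _ ≤ (p + 1 + σ + σ ^ 2) * (1 + ε - b) + (p - σ) * (1 + ε + b) := by gcongr
    _ = 2 * p * (1 + ε) + (1 + ε - b) - 2 * (σ * b) + σ * (σ * (1 + ε - b)) := by ring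
    _ ≤ 2 * p * (1 + ε) + (1 + ε - b) - σ * b := by linarith

theorem half_le_sub_mul (hσ : 0 ≤ σ) (hε : 0 ≤ ε) (hε' : ε ≤ 1 / 100)
    (hb2 : b ^ 2 = ε ^ 2 + 2 * ε) (hσε : σ ^ 2 ≤ ε) :
    (1 + ε + b) / 2 ≤ (1 + ε - b) - σ * b := by
  have hσ' : σ ≤ 1 / 10 := abs_le_of_sq_le_sq' (by linarith) (by norm_num) |>.2
  have hb' : b ≤ 3 / 20 := abs_le_of_sq_le_sq' (by nlinarith) (by norm_num) |>.2
  nlinarith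

/-- The inequality is a convex combination, with weights `t / N` and `1 - t / N`, of its extreme
cases `t = N` and `t = 0`. -/
theorem supersolution_inequality (ht : 0 ≤ t) (hN : 0 < N) (htN : 2 * p + t ≤ N) (hσ : 0 ≤ σ)
    (hσp : σ ≤ p) (hε : 0 ≤ ε) (hε' : ε ≤ 1 / 100) (hb : 0 ≤ b) (hb2 : b ^ 2 = ε ^ 2 + 2 * ε)
    (hσε : σ ^ 2 ≤ ε) :
    t / N * ((p + 1) ^ 2 * (1 + ε - b) / (p + 1 - σ)) + (t + 1) / N * ((p - σ) * (1 + ε + b)) ≤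
      2 * p * (ε + t / N) + (1 + ε - b) - σ * b := by
  set ν := t / N
  have hp : 0 ≤ p := hσ.trans hσp
  have : 0 ≤ ν := by positivity
  have hν1 : ν ≤ 1 := (div_le_one hN).2 (by linarith)
  have hpν : (p - σ) / N ≤ (1 - ν) / 2 := by
    have hνN : ν * N = t := div_mul_cancel₀ _ hN.ne'
    rw [div_le_div_iff₀ hN two_pos]
    linarith
  calc ν * ((p + 1) ^ 2 * (1 + ε - b) / (p + 1 - σ)) + (t + 1) / N * ((p - σ) * (1 + ε + b))
      = ν * ((p + 1) ^ 2 * (1 + ε - b) / (p + 1 - σ) + (p - σ) * (1 + ε + b)) +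
          (p - σ) / N * (1 + ε + b) := by ring
    _ ≤ ν * (2 * p * (1 + ε) + (1 + ε - b) - σ * b) + (1 - ν) / 2 * (1 + ε + b) := by
        gcongr
        exact sq_mul_div_add_mul_le hσ hσp hε hb hb2 hσε
    _ = ν * (2 * p * (1 + ε) + (1 + ε - b) - σ * b) + (1 - ν) * ((1 + ε + b) / 2) := by ring
    _ ≤ ν * (2 * p * (1 + ε) + (1 + ε - b) - σ * b) + (1 - ν) * ((1 + ε - b) - σ * b) := by
        gcongr
        exact half_le_sub_mul hσ hε hε' hb2 hσε
    _ ≤ 2 * p * (ε + ν) + (1 + ε - b) - σ * b := by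
        linarith [mul_nonneg (mul_nonneg hp hε) (sub_nonneg.2 hν1)]

theorem two_mul_sub_le_div (hκ : 0 < κ) (hN : 0 < N) (t : ℕ) :
    2 * ((t : ℝ) - 1) / N - κ ≤ t * (t - 1) / N ^ 2 / κ := by
  rcases Nat.eq_zero_or_pos t with rfl | ht
  · have : 0 ≤ 2 / N + κ := by positivity
    simpa [neg_div] using by linarith
  have ht' : (1 : ℝ) ≤ t := by exact_mod_cast ht
  rw [le_div_iff₀ hκ]
  calc (2 * ((t : ℝ) - 1) / N - κ) * κ
      = 2 * ((t - 1) / N) * κ - κ ^ 2 := by ring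
    _ ≤ ((t - 1) / N) ^ 2 := by
        linarith [sq_nonneg (((t : ℝ) - 1) / N - κ)]
    _ ≤ t * (t - 1) / N ^ 2 := by
        rw [div_pow]
        gcongr
        nlinarith

theorem subsolution_inequality (hb : 0 < b) (hN : 0 < N) (hp : 0 ≤ p) (hεb : ε ≤ b) :
    2 * p * (ε + (N - 2 * p) / N) + (1 + ε - b) - (2 / N + 3 * (1 + ε - b) / (N * b)) ≤
      (1 + 3 / (N * b)) * p * (1 + ε + b) +
        (2 * (N - 2 * p - 1) / N - (1 + 3 / (N * b))) * ((p + 1) * (1 + ε - b)) := by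
  have hdiff : (1 + 3 / (N * b)) * p * (1 + ε + b) +
        (2 * (N - 2 * p - 1) / N - (1 + 3 / (N * b))) * ((p + 1) * (1 + ε - b)) -
      (2 * p * (ε + (N - 2 * p) / N) + (1 + ε - b) - (2 / N + 3 * (1 + ε - b) / (N * b))) =
      (b - ε) * (4 * p ^ 2 + 6 * p + 2) / N := by
    field_simp
    ring
  have : 0 ≤ (b - ε) * (4 * p ^ 2 + 6 * p + 2) / N := by
    have := sub_nonneg.2 hεb
    positivity
  linarith

end Scalar

end BogoliubovThreeModes

open BogoliubovThreeModes

namespace ThreeModeSystem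

variable {d : ℕ} (S : ThreeModeSystem d)

theorem N_cast_pos : (0 : ℝ) < S.N := Nat.cast_pos.2 S.N_pos

theorem two_le_N : 2 ≤ S.N := by
  obtain ⟨k, hk⟩ := S.N_even
  have := S.N_pos
  omega

theorem j_ne_neg : S.j ≠ -S.j := fun h => S.j_ne (self_eq_neg.1 h)

/-- The number of particles in the modes `±j`. -/
def pairs (n : Mode d →₀ ℕ) : ℕ := n S.j + n (-S.j)

/-- The configuration obtained from `n` when `W^*` moves two particles of the zero mode into the
modes `±j`; it is only meaningful if `2 ≤ n 0`, the subtraction being truncated otherwise. -/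
noncomputable def pairUp (n : Mode d →₀ ℕ) : Mode d →₀ ℕ :=
  n - Finsupp.single 0 2 + (Finsupp.single S.j 1 + Finsupp.single (-S.j) 1)

theorem pairUp_zero (n : Mode d →₀ ℕ) : S.pairUp n 0 = n 0 - 2 := by
  simp [pairUp, S.j_ne]

theorem pairUp_j (n : Mode d →₀ ℕ) : S.pairUp n S.j = n S.j + 1 := by
  simp [pairUp, S.j_ne, S.j_ne_neg]

theorem pairUp_neg_j (n : Mode d →₀ ℕ) : S.pairUp n (-S.j) = n (-S.j) + 1 := by
  simp [pairUp, S.j_ne, S.j_ne_neg]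

theorem pairs_pairUp (n : Mode d →₀ ℕ) : S.pairs (S.pairUp n) = S.pairs n + 2 := by
  rw [pairs, pairUp_j, pairUp_neg_j, pairs]
  ring

theorem degree_pairUp {n : Mode d →₀ ℕ} (h0 : 2 ≤ n 0) : (S.pairUp n).degree = n.degree := by
  have h := congrArg Finsupp.degree (tsub_add_cancel_of_le (Finsupp.single_le_iff.2 h0))
  simp only [pairUp, map_add, Finsupp.degree_single] at h ⊢
  omega

theorem exists_pairUp_eq {n : Mode d →₀ ℕ} (hj : n S.j ≠ 0) (hnj : n (-S.j) ≠ 0) :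
    ∃ m : Mode d →₀ ℕ, 2 ≤ m 0 ∧ S.pairUp m = n := by
  have hle : Finsupp.single S.j 1 + Finsupp.single (-S.j) 1 ≤ n := fun k => by
    by_cases hk : k = S.j
    · subst hk
      simp [S.j_ne_neg]
      omega
    · by_cases hk' : k = -S.j
      · subst hk'
        simp [S.j_ne_neg]
        omega
      · simp [Ne.symm hk, Ne.symm hk']
  exact ⟨n - (Finsupp.single S.j 1 + Finsupp.single (-S.j) 1) + Finsupp.single 0 2, by simp,
    by rw [pairUp, add_tsub_cancel_right, tsub_add_cancel_of_le hle]⟩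

theorem pairUp_induction {P : (Mode d →₀ ℕ) → Prop} (base : ∀ n, n 0 < 2 → P n)
    (step : ∀ n, 2 ≤ n 0 → P (S.pairUp n) → P n) (n : Mode d →₀ ℕ) : P n := by
  induction h : n 0 using Nat.strong_induction_on generalizing n with
  | _ t ih =>
    rcases lt_or_ge (n 0) 2 with h0 | h0
    · exact base n h0
    · exact step n h0 (ih _ (by rw [pairUp_zero]; omega) _ rfl)

open Classical in
theorem sum_interacting_modes (n : Mode d →₀ ℕ) :
    ∑ k ∈ {S.j, -S.j, 0}, n k = S.pairs n + n 0 := by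
  rw [Finset.sum_insert (by simp [S.j_ne_neg, S.j_ne]), Finset.sum_pair (by simp [S.j_ne]), pairs,
    add_assoc]

theorem pairs_add_zero_le_degree (n : Mode d →₀ ℕ) : S.pairs n + n 0 ≤ n.degree := by
  classical
  rw [← sum_interacting_modes]
  exact Finset.sum_le_sum_of_ne_zero fun k _ hk => by simpa using hk

/-- The matrix element of `W` between the configurations `n` and `S.pairUp n`; the factor with the
truncated subtraction `n 0 - 1` makes it vanish unless `2 ≤ n 0`. -/
noncomputable def coupling (n : Mode d →₀ ℕ) : ℝ :=
  S.φ / S.N * (√(n 0) * √((n 0 - 1 : ℕ)) * √((n S.j : ℝ) + 1) * √((n (-S.j) : ℝ) + 1))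

theorem coupling_sq (n : Mode d →₀ ℕ) :
    S.coupling n ^ 2 =
      (S.φ / S.N) ^ 2 * ((n 0 : ℝ) * (n 0 - 1) * ((n S.j + 1) * (n (-S.j) + 1))) := by
  have hzero : (n 0 : ℝ) * ((n 0 - 1 : ℕ) : ℝ) = n 0 * (n 0 - 1) := by
    cases n 0 <;> simp
  rw [coupling]
  simp only [mul_pow]
  rw [Real.sq_sqrt (by positivity), Real.sq_sqrt (by positivity), Real.sq_sqrt (by positivity),
    Real.sq_sqrt (by positivity), hzero, mul_assoc ((n 0 : ℝ) * (n 0 - 1))]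

theorem coupling_eq_zero {n : Mode d →₀ ℕ} (h0 : n 0 < 2) : S.coupling n = 0 := by
  have : (n 0 - 1 : ℕ) = 0 := by omega
  simp [coupling, this]

theorem amp_W (ψ : S.Space) (n : Mode d →₀ ℕ) :
    amp (S.W ψ) n = S.coupling n * amp ψ (S.pairUp n) := by
  have hN := S.two_le_N
  have hpair : n - Finsupp.single 0 1 - Finsupp.single 0 1 + Finsupp.single S.j 1 +
      Finsupp.single (-S.j) 1 = S.pairUp n := by
    rw [pairUp, tsub_tsub, ← Finsupp.single_add, add_assoc]
  simp only [W, smul_apply, ContinuousLinearMap.comp_apply, amp_smul]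
  rw [amp_creat S.N_pos, amp_creat (by omega), amp_annih, amp_annih, hpair]
  simp [coupling, S.j_ne, S.j_ne_neg]
  ring

theorem amp_Wstar_pairUp (ψ : S.Space) {n : Mode d →₀ ℕ} (h0 : 2 ≤ n 0) :
    amp (S.Wstar ψ) (S.pairUp n) = S.coupling n * amp ψ n := by
  have hN := S.two_le_N
  have hpair : S.pairUp n - Finsupp.single S.j 1 - Finsupp.single (-S.j) 1 =
      n - Finsupp.single 0 2 := by
    rw [pairUp, tsub_tsub, add_tsub_cancel_right]
  have hback : n - Finsupp.single 0 2 + Finsupp.single 0 1 + Finsupp.single 0 1 = n := by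
    rw [add_assoc, ← Finsupp.single_add, tsub_add_cancel_of_le (Finsupp.single_le_iff.2 h0)]
  have hzero : ((n 0 - 2 : ℕ) : ℝ) + 1 = (n 0 - 1 : ℕ) := by
    exact_mod_cast (by omega : n 0 - 2 + 1 = n 0 - 1)
  have hzero' : ((n 0 - 1 : ℕ) : ℝ) + 1 = n 0 := by
    exact_mod_cast (by omega : n 0 - 1 + 1 = n 0)
  simp only [Wstar, smul_apply, ContinuousLinearMap.comp_apply, amp_smul]
  rw [amp_creat S.N_pos, amp_creat (by omega), amp_annih, amp_annih, hpair, hback]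
  simp [coupling, pairUp, S.j_ne, S.j_ne_neg, hzero, hzero']
  ring

theorem amp_Wstar_eq_zero (ψ : S.Space) {n : Mode d →₀ ℕ} (hn : n S.j = 0 ∨ n (-S.j) = 0) :
    amp (S.Wstar ψ) n = 0 := by
  have hN := S.two_le_N
  simp only [Wstar, smul_apply, ContinuousLinearMap.comp_apply, amp_smul]
  rw [amp_creat S.N_pos, amp_creat (by omega)]
  rcases hn with hj | hj <;> simp [hj]

section Hamiltonian

/-- The kinetic energy of a configuration in the modes other than `±j`, for any particle number. -/
noncomputable def restEnergy (n : Mode d →₀ ℕ) : ℝ := ∑ k ∈ n.support \ {S.j, -S.j}, S.kin k * n k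

/-- The eigenvalue of `Ĥ⁰` at a configuration. -/
noncomputable def pairEnergy (n : Mode d →₀ ℕ) : ℝ :=
  (S.kin S.j + S.φ / S.N * n 0) * S.pairs n

/-- The diagonal matrix element of the Hamiltonian at a configuration. -/
noncomputable def diagEnergy (n : Mode d →₀ ℕ) : ℝ := S.restEnergy n + S.pairEnergy n

theorem kin_nonneg (k : Mode d) : 0 ≤ S.kin k := Finset.sum_nonneg fun _ _ => sq_nonneg _

theorem restEnergy_nonneg (n : Mode d →₀ ℕ) : 0 ≤ S.restEnergy n :=
  Finset.sum_nonneg fun k _ => mul_nonneg (S.kin_nonneg k) (Nat.cast_nonneg _)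

theorem pairEnergy_nonneg (n : Mode d →₀ ℕ) : 0 ≤ S.pairEnergy n := by
  have hkin := S.kin_nonneg S.j
  have hφ := S.φ_pos
  exact mul_nonneg (by positivity) (Nat.cast_nonneg _)

theorem diagEnergy_nonneg (n : Mode d →₀ ℕ) : 0 ≤ S.diagEnergy n :=
  add_nonneg (S.restEnergy_nonneg n) (S.pairEnergy_nonneg n)

theorem isDiagonal_H0hat : IsDiagonal S.H0hat fun n => S.pairEnergy n.1 := by
  have hnum (k : Mode d) (ψ : S.Space) (n : Mode d →₀ ℕ) :
      amp (num S.N k ψ) n = (n k : ℝ) * amp ψ n :=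
    (isDiagonal_iff_amp (g := fun n => n k)).1 (isDiagonal_num S.N_pos k) ψ n
  refine isDiagonal_iff_amp.2 fun ψ n => ?_
  rw [H0hat, ContinuousLinearMap.comp_apply, add_apply, add_apply, smul_apply, smul_apply,
    ContinuousLinearMap.id_apply]
  simp only [amp_add, amp_smul, hnum, pairEnergy, pairs]
  push_cast
  ring

theorem HBog_apply (ψ : S.HBog.domain) (n : Occ d S.N) :
    S.HBog ψ n =
      S.diagEnergy n.1 * (ψ : S.Space) n + S.W (ψ : S.Space) n + S.Wstar (ψ : S.Space) n := by
  have hsplit : S.HBog ψ n = S.restEnergy n.1 * (ψ : S.Space) n +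
      (S.H0hat (ψ : S.Space) n + S.W (ψ : S.Space) n + S.Wstar (ψ : S.Space) n) := rfl
  rw [hsplit, ← amp_coe (S.H0hat _), isDiagonal_iff_amp.1 S.isDiagonal_H0hat, amp_coe, diagEnergy]
  push_cast
  ring

/-- The configurations with all particles in the modes `0` and `±j`, and as many in `j` as in `-j`:
they are the ones reached from the condensate. -/
def IsPairState (n : Mode d →₀ ℕ) : Prop :=
  n S.j = n (-S.j) ∧ ∀ k, k ≠ 0 → k ≠ S.j → k ≠ -S.j → n k = 0

variable {S} in
theorem IsPairState.pairUp {n : Mode d →₀ ℕ} (hn : S.IsPairState n) :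
    S.IsPairState (S.pairUp n) := by
  refine ⟨by rw [pairUp_j, pairUp_neg_j, hn.1], fun k h0 hj hnj => ?_⟩
  simp [ThreeModeSystem.pairUp, hn.2 k h0 hj hnj, hj.symm, hnj.symm]

variable {S} in
theorem IsPairState.diagEnergy_eq {n : Mode d →₀ ℕ} (hn : S.IsPairState n) :
    S.diagEnergy n = S.pairEnergy n := by
  rw [diagEnergy, restEnergy, Finset.sum_eq_zero, zero_add]
  intro k hk
  simp only [Finset.mem_sdiff, Finset.mem_insert, Finset.mem_singleton, not_or] at hk
  by_cases h0 : k = 0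
  · simp [h0, kin]
  · rw [hn.2 k h0 hk.2.1 hk.2.2, Nat.cast_zero, mul_zero]

variable {S} in
theorem IsPairState.pairs_add_zero {n : Mode d →₀ ℕ} (hn : S.IsPairState n) :
    S.pairs n + n 0 = n.degree := by
  classical
  rw [← sum_interacting_modes, Finsupp.degree_apply]
  refine (Finset.sum_subset (fun k hk => ?_) fun k _ hk => Finsupp.notMem_support_iff.1 hk).symm
  by_contra hmem
  simp only [Finset.mem_insert, Finset.mem_singleton, not_or] at hmem
  exact Finsupp.mem_support_iff.1 hk (hn.2 k hmem.2.2 hmem.1 hmem.2.1)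

/-- The configuration of the state `S.eta`. -/
noncomputable def condensate : Mode d →₀ ℕ := Finsupp.single 0 S.N

theorem pairs_condensate : S.pairs S.condensate = 0 := by
  simp [pairs, condensate, S.j_ne]

theorem isPairState_condensate : S.IsPairState S.condensate :=
  ⟨by simp [condensate, S.j_ne], fun k h0 _ _ => by simp [condensate, h0]⟩

end Hamiltonian

section Sectors

/-- The configurations spanning the range of `S.Q i`, among those with `N` particles. -/
def sectorConfigs (i : ℕ) : Set (Mode d →₀ ℕ) :=
  {n | S.pairs n + i = S.N ∨ S.pairs n + i + 1 = S.N}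

variable {S} {i : ℕ} {n : Mode d →₀ ℕ} {ψ : S.Space} {z : ℝ}

theorem mem_sector_iff :
    ψ ∈ S.sector i ↔ ∀ n ∉ {n : Occ d S.N | n.1 ∈ S.sectorConfigs i}, ψ n = 0 := by
  refine forall_congr' fun n => ?_
  simp only [sectorConfigs, pairs, Set.mem_ofPred_eq, not_or, and_imp]

theorem amp_eq_zero_of_mem_sector (hψ : ψ ∈ S.sector i) (hn : n ∉ S.sectorConfigs i) :
    amp ψ n = 0 := by
  by_cases hdeg : n.degree = S.N
  · exact (amp_of_degree_eq ψ hdeg).trans (mem_sector_iff.1 hψ ⟨n, hdeg⟩ hn)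
  · exact amp_of_degree_ne ψ hdeg

theorem amp_W_eq_zero_of_mem_sector (hψ : ψ ∈ S.sector i) (hn : n ∈ S.sectorConfigs i) :
    amp (S.W ψ) n = 0 := by
  have hup : S.pairUp n ∉ S.sectorConfigs i := by
    rcases hn with hn | hn <;> rintro (h | h) <;> rw [pairs_pairUp] at h <;> omega
  rw [amp_W, amp_eq_zero_of_mem_sector hψ hup, mul_zero]

theorem amp_Wstar_eq_zero_of_mem_sector (hψ : ψ ∈ S.sector i) (hn : n ∈ S.sectorConfigs i) :
    amp (S.Wstar ψ) n = 0 := by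
  by_cases hj : n S.j = 0 ∨ n (-S.j) = 0
  · exact S.amp_Wstar_eq_zero ψ hj
  obtain ⟨m, hm, rfl⟩ := S.exists_pairUp_eq (not_or.1 hj).1 (not_or.1 hj).2
  have hdown : m ∉ S.sectorConfigs i := by
    rcases hn with hn | hn <;> rintro (h | h) <;> rw [pairs_pairUp] at hn <;> omega
  rw [amp_Wstar_pairUp _ _ hm, amp_eq_zero_of_mem_sector hψ hdown, mul_zero]

theorem HBog_apply_of_mem_sector {ψ : S.HBog.domain} (hψ : (ψ : S.Space) ∈ S.sector i)
    {n : Occ d S.N} (hn : n.1 ∈ S.sectorConfigs i) :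
    S.HBog ψ n = S.diagEnergy n.1 * (ψ : S.Space) n := by
  rw [HBog_apply, ← amp_coe (S.W _), ← amp_coe (S.Wstar _), amp_W_eq_zero_of_mem_sector hψ hn,
    amp_Wstar_eq_zero_of_mem_sector hψ hn, add_zero, add_zero]

theorem mem_domain_HBog
    (hψ : Memℓp (E := fun _ : Occ d S.N => ℂ) (fun n => (S.diagEnergy n.1 : ℂ) * ψ n) 2) :
    ψ ∈ S.HBog.domain := by
  have hrest : Memℓp (E := fun _ : Occ d S.N => ℂ) (fun n => (S.restEnergy n.1 : ℂ) * ψ n) 2 := by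
    refine hψ.mono' fun n => ?_
    have hle : S.restEnergy n.1 ≤ S.diagEnergy n.1 :=
      le_add_of_nonneg_right (S.pairEnergy_nonneg n.1)
    rw [norm_mul, norm_mul, Complex.norm_of_nonneg (S.diagEnergy_nonneg n.1),
      Complex.norm_of_nonneg (S.restEnergy_nonneg n.1)]
    gcongr
  exact hrest

variable (S i)

theorem isDiagonal_Q : IsDiagonal (S.Q i) fun n => (S.sectorConfigs i).indicator 1 n.1 :=
  isDiagonal_starProjection fun _ => mem_sector_iff

theorem exists_isCompressedResolvent_HBog (hz : z < 0) :
    ∃ T, IsCompressedResolvent S.HBog (S.Q i) z T ∧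
      IsDiagonal T fun n =>
        (S.sectorConfigs i).indicator (fun m => (S.diagEnergy m - z)⁻¹) n.1 := by
  obtain ⟨T, hT, hdiag⟩ := exists_isCompressedResolvent_isDiagonal (H := S.HBog)
    (K := S.sector i) (s := {n | n.1 ∈ S.sectorConfigs i}) (h := fun n => S.diagEnergy n.1)
    (fun _ => mem_sector_iff) (fun _ _ => mem_domain_HBog)
    (fun _ hψ _ hn => HBog_apply_of_mem_sector hψ hn) (neg_pos.2 hz)
    fun n _ => by linarith [S.diagEnergy_nonneg n.1]
  exact ⟨T, hT, hdiag⟩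

theorem isDiagonal_R (hz : z < 0) : IsDiagonal (S.R i z) fun n =>
    (S.sectorConfigs i).indicator (fun m => (S.diagEnergy m - z)⁻¹) n.1 := by
  obtain ⟨T, hT, hdiag⟩ := S.exists_isCompressedResolvent_HBog i hz
  rwa [R, hT.compressedResolvent_eq]

end Sectors

section SchurComplement

/-- The Schur complement (at spectral parameter `z`) of the Hamiltonian at a configuration after
all configurations with more pairs have been eliminated; it is a finite continued fraction. -/
noncomputable def schur (z : ℝ) (n : Mode d →₀ ℕ) : ℝ :=
  if n 0 < 2 then S.diagEnergy n - z
  else S.diagEnergy n - z - S.coupling n ^ 2 / schur z (S.pairUp n)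
termination_by n 0
decreasing_by rw [pairUp_zero]; omega

/-- The eigenvalues of the effective interactions `Γ`. -/
noncomputable def selfEnergy (z : ℝ) (n : Mode d →₀ ℕ) : ℝ :=
  S.coupling n ^ 2 / S.schur z (S.pairUp n)

theorem schur_eq (z : ℝ) (n : Mode d →₀ ℕ) :
    S.schur z n = S.diagEnergy n - z - S.selfEnergy z n := by
  rw [schur, selfEnergy]
  split_ifs with h0
  · rw [S.coupling_eq_zero h0, zero_pow two_ne_zero, zero_div, sub_zero]
  · rfl

theorem schur_of_zero_lt_two (z : ℝ) {n : Mode d →₀ ℕ} (h0 : n 0 < 2) :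
    S.schur z n = S.diagEnergy n - z := by
  rw [schur, if_pos h0]

theorem isDiagonal_W_mul_Wstar {T : S.Space →L[ℂ] S.Space} {t : (Mode d →₀ ℕ) → ℝ}
    (hT : IsDiagonal T fun n => t n.1) :
    IsDiagonal (S.W * T * S.Wstar) fun n => S.coupling n.1 ^ 2 * t (S.pairUp n.1) := by
  refine (isDiagonal_iff_amp (g := fun n => S.coupling n ^ 2 * t (S.pairUp n))).2 fun ψ n => ?_
  rw [mul_apply_eq_comp, mul_apply_eq_comp, amp_W, isDiagonal_iff_amp.1 hT]
  rcases lt_or_ge (n 0) 2 with h0 | h0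
  · simp [S.coupling_eq_zero h0]
  · rw [S.amp_Wstar_pairUp ψ h0]
    push_cast
    ring

theorem coupling_sq_le {n : Mode d →₀ ℕ} (hn : n.degree = S.N) :
    S.coupling n ^ 2 ≤ (S.φ * S.N) ^ 2 := by
  rcases lt_or_ge (n 0) 2 with h0 | h0
  · rw [S.coupling_eq_zero h0, zero_pow two_ne_zero]
    positivity
  have hdeg := S.pairs_add_zero_le_degree n
  rw [hn, pairs] at hdeg
  have hN := S.N_cast_pos
  have hzero : (n 0 : ℝ) ≤ S.N := by exact_mod_cast (by omega : n 0 ≤ S.N)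
  have hzero' : (2 : ℝ) ≤ n 0 := by exact_mod_cast h0
  have hj : (n S.j : ℝ) + 1 ≤ S.N := by exact_mod_cast (by omega : n S.j + 1 ≤ S.N)
  have hnj : (n (-S.j) : ℝ) + 1 ≤ S.N := by exact_mod_cast (by omega : n (-S.j) + 1 ≤ S.N)
  calc S.coupling n ^ 2
      = (S.φ / S.N) ^ 2 * ((n 0 : ℝ) * (n 0 - 1) * ((n S.j + 1) * (n (-S.j) + 1))) :=
        S.coupling_sq n
    _ ≤ (S.φ / S.N) ^ 2 * ((S.N : ℝ) * S.N * (S.N * S.N)) := by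
        gcongr
        · linarith
        · linarith
    _ = (S.φ * S.N) ^ 2 := by
        field_simp

variable {S} {z m : ℝ} (hz : z < 0) (hm : 0 < m)
  (hschur : ∀ n : Mode d →₀ ℕ, n.degree = S.N → 1 ≤ S.pairs n → m ≤ S.schur z n)

include hm hschur in
theorem selfEnergy_mem_Icc {n : Mode d →₀ ℕ} (hn : n.degree = S.N) :
    S.selfEnergy z n ∈ Set.Icc 0 ((S.φ * S.N) ^ 2 / m) := by
  rcases lt_or_ge (n 0) 2 with h0 | h0
  · rw [selfEnergy, S.coupling_eq_zero h0, zero_pow two_ne_zero, zero_div]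
    exact ⟨le_rfl, by positivity⟩
  have hup : m ≤ S.schur z (S.pairUp n) :=
    hschur _ ((S.degree_pairUp h0).trans hn) (by rw [pairs_pairUp]; omega)
  exact ⟨div_nonneg (sq_nonneg _) (hm.le.trans hup),
    div_le_div₀ (by positivity) (S.coupling_sq_le hn) hm hup⟩

theorem one_le_pairs_of_mem_sectorConfigs {i : ℕ} (hi : i + 2 ≤ S.N) {n : Mode d →₀ ℕ}
    (hn : n ∈ S.sectorConfigs i) : 1 ≤ S.pairs n := by
  rcases hn with hn | hn <;> omega

include hz hm hschur in
theorem norm_mul_R_lt_one {i : ℕ} (hi : i + 2 ≤ S.N) {G : S.Space →L[ℂ] S.Space}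
    (hG : IsDiagonal G fun n => (S.sectorConfigs i).indicator (S.selfEnergy z) n.1) :
    ‖G * S.R i z‖ < 1 := by
  set M := (S.φ * S.N) ^ 2 / m
  have : 0 ≤ M := by positivity
  suffices h : ‖G * S.R i z‖ ≤ M / (M + m) from h.trans_lt ((div_lt_one (by positivity)).2
    (lt_add_of_pos_right M hm))
  refine (hG.mul (S.isDiagonal_R i hz)).norm_le (by positivity) fun n => ?_
  by_cases hn : n.1 ∈ S.sectorConfigs i
  · obtain ⟨hg, hgM⟩ := selfEnergy_mem_Icc hm hschur n.2
    have hgap : S.selfEnergy z n.1 + m ≤ S.diagEnergy n.1 - z := by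
      have := hschur n.1 n.2 (one_le_pairs_of_mem_sectorConfigs hi hn)
      rw [schur_eq] at this
      linarith
    have hpos : 0 < S.diagEnergy n.1 - z := by linarith
    simp only [Pi.mul_apply, Set.indicator_of_mem hn, ← div_eq_mul_inv]
    rw [abs_of_nonneg (div_nonneg hg hpos.le), div_le_div_iff₀ hpos (by positivity)]
    calc S.selfEnergy z n.1 * (M + m) ≤ M * (S.selfEnergy z n.1 + m) := by nlinarith
      _ ≤ M * (S.diagEnergy n.1 - z) := by gcongr
  · simp only [Pi.mul_apply, Set.indicator_of_notMem hn, zero_mul, abs_zero]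
    positivity

include hz hm hschur in
theorem isDiagonal_R_mul_tsum {i : ℕ} (hi : i + 2 ≤ S.N) {G : S.Space →L[ℂ] S.Space}
    (hG : IsDiagonal G fun n => (S.sectorConfigs i).indicator (S.selfEnergy z) n.1) :
    IsDiagonal (S.R i z * ∑' l : ℕ, (G * S.R i z) ^ l) fun n =>
      (S.sectorConfigs i).indicator (S.schur z)⁻¹ n.1 := by
  have hR := S.isDiagonal_R i hz
  refine (hR.mul ((hG.mul hR).tsum_pow (norm_mul_R_lt_one hz hm hschur hi hG))).congr fun n => ?_
  by_cases hn : n.1 ∈ S.sectorConfigs i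
  · have hD : S.diagEnergy n.1 - z ≠ 0 := by linarith [S.diagEnergy_nonneg n.1]
    simp only [Pi.mul_apply, Pi.inv_apply, Pi.sub_apply, Pi.one_apply, Set.indicator_of_mem hn]
    rw [schur_eq, ← mul_inv, mul_sub, mul_one, mul_left_comm, mul_inv_cancel₀ hD, mul_one]
  · simp [hn]

include hz hm hschur in
theorem isDiagonal_Gam (k : ℕ) (hk : 2 * k ≤ S.N) : IsDiagonal (S.Gam z k) fun n =>
    (S.sectorConfigs (2 * k)).indicator (S.selfEnergy z) n.1 := by
  induction k with
  | zero =>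
    refine IsDiagonal.zero.congr fun n => ?_
    by_cases hn : n.1 ∈ S.sectorConfigs (2 * 0)
    · have h0 : n.1 0 < 2 := by
        have hdeg := S.pairs_add_zero_le_degree n.1
        rw [n.2] at hdeg
        rcases hn with hn | hn <;> omega
      rw [Pi.zero_apply, Set.indicator_of_mem hn, selfEnergy, S.coupling_eq_zero h0,
        zero_pow two_ne_zero, zero_div]
    · rw [Pi.zero_apply, Set.indicator_of_notMem hn]
  | succ k ih =>
    have hQ := S.isDiagonal_Q (2 * k)
    have hQ' := S.isDiagonal_Q (2 * k + 2)
    have hT := isDiagonal_R_mul_tsum hz hm hschur (by omega) (ih (by omega))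
    have hQTQ := ((hQ.mul hT).mul hQ).congr
      (g' := fun n => (S.sectorConfigs (2 * k)).indicator (S.schur z)⁻¹ n.1) fun n => by
        by_cases hn : n.1 ∈ S.sectorConfigs (2 * k) <;> simp [hn]
    have hGam : S.Gam z (k + 1) = S.Q (2 * k + 2) * (S.W * (S.Q (2 * k) * (S.R (2 * k) z *
        ∑' l : ℕ, (S.Gam z k * S.R (2 * k) z) ^ l) * S.Q (2 * k)) * S.Wstar) *
        S.Q (2 * k + 2) := by
      simp only [Gam, mul_assoc]
    rw [hGam]
    refine ((hQ'.mul (S.isDiagonal_W_mul_Wstar hQTQ)).mul hQ').congr fun n => ?_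
    by_cases hn : n.1 ∈ S.sectorConfigs (2 * k + 2)
    · have hup : S.pairUp n.1 ∈ S.sectorConfigs (2 * k) := by
        simpa only [sectorConfigs, Set.mem_ofPred_eq, pairs_pairUp, add_right_comm, add_assoc,
          add_comm 2] using hn
      simp [hn, hup, selfEnergy, mul_add, div_eq_mul_inv]
    · simp [hn, mul_add]

include hz hm hschur in
theorem flowDefined : S.FlowDefined z := by
  rintro i hi hiN
  obtain ⟨k, rfl⟩ := hi.two_dvd
  have hG := isDiagonal_Gam hz hm hschur k (by omega)
  obtain ⟨T, hT, -⟩ := S.exists_isCompressedResolvent_HBog (2 * k) hz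
  refine ⟨⟨T, hT⟩, ?_⟩
  rw [Nat.mul_div_cancel_left k two_pos]
  exact summable_geometric_of_norm_lt_one (norm_mul_R_lt_one hz hm hschur hiN hG)

include hz hm hschur in
theorem f_eq_schur : S.f z = S.schur z S.condensate := by
  classical
  obtain ⟨k, hk⟩ : ∃ k, S.N - 2 = 2 * k := (S.N_even.tsub even_two).two_dvd
  have hN := S.two_le_N
  have hT := isDiagonal_R_mul_tsum hz hm hschur (i := 2 * k) (by omega)
    (isDiagonal_Gam hz hm hschur k (by omega))
  have hup : S.pairUp S.condensate ∈ S.sectorConfigs (2 * k) :=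
    Or.inl (by rw [pairs_pairUp, pairs_condensate]; omega)
  have hdiag : S.diagEnergy S.condensate = 0 := by
    rw [S.isPairState_condensate.diagEnergy_eq, pairEnergy, pairs_condensate, Nat.cast_zero,
      mul_zero]
  have hamp : (inner ℂ S.eta ((S.W * (S.R (2 * k) z * ∑' l : ℕ, (S.Gam z k * S.R (2 * k) z) ^ l) *
      S.Wstar) S.eta)) = S.selfEnergy z S.condensate := by
    rw [eta, lp.inner_single_left, S.isDiagonal_W_mul_Wstar hT]
    have hsymbol : (S.sectorConfigs (2 * k)).indicator (S.schur z)⁻¹ (S.pairUp S.condensate) =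
        (S.schur z (S.pairUp S.condensate))⁻¹ := Set.indicator_of_mem hup _
    rw [condensate] at hsymbol ⊢
    simp [selfEnergy, div_eq_mul_inv, hsymbol]
  rw [f, hk, Nat.mul_div_cancel_left k two_pos, mul_assoc S.W, hamp, schur_eq, hdiag,
    Complex.ofReal_re, zero_sub]

end SchurComplement

section Comparison

variable {S} {A : Set (Mode d →₀ ℕ)} {u : (Mode d →₀ ℕ) → ℝ} {z : ℝ}

theorem le_schur_of_supersolution (hA : ∀ n ∈ A, 2 ≤ n 0 → S.pairUp n ∈ A)
    (hpos : ∀ n ∈ A, 2 ≤ n 0 → 0 < u (S.pairUp n))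
    (hu : ∀ n ∈ A, u n + S.coupling n ^ 2 / u (S.pairUp n) ≤ S.diagEnergy n - z) {n}
    (hn : n ∈ A) : u n ≤ S.schur z n := by
  induction n using S.pairUp_induction with
  | base n h0 => simpa [schur_of_zero_lt_two, h0, S.coupling_eq_zero h0] using hu n hn
  | step n h0 ih =>
    have hle : S.selfEnergy z n ≤ S.coupling n ^ 2 / u (S.pairUp n) :=
      div_le_div_of_nonneg_left (sq_nonneg _) (hpos n hn h0) (ih (hA n hn h0))
    rw [schur_eq]
    linarith [hu n hn]

theorem schur_le_of_subsolution (hA : ∀ n ∈ A, 2 ≤ n 0 → S.pairUp n ∈ A)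
    (hpos : ∀ n ∈ A, 2 ≤ n 0 → 0 < S.schur z (S.pairUp n))
    (hu : ∀ n ∈ A, S.diagEnergy n - z ≤ u n + S.coupling n ^ 2 / u (S.pairUp n)) {n}
    (hn : n ∈ A) : S.schur z n ≤ u n := by
  induction n using S.pairUp_induction with
  | base n h0 => simpa [schur_of_zero_lt_two, h0, S.coupling_eq_zero h0] using hu n hn
  | step n h0 ih =>
    have hle : S.coupling n ^ 2 / u (S.pairUp n) ≤ S.selfEnergy z n :=
      div_le_div_of_nonneg_left (sq_nonneg _) (hpos n hn h0) (ih (hA n hn h0))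
    rw [schur_eq]
    linarith [hu n hn]

end Comparison

section Barriers

/-- Half the difference, in units of `φ`, between the two roots `-φ (1 + ε ± gap)` whose larger one
is the Bogoliubov energy. -/
noncomputable def gap : ℝ := √(S.eps ^ 2 + 2 * S.eps)

theorem kin_j_pos : 0 < S.kin S.j := by
  obtain ⟨i, hi⟩ := Function.ne_iff.1 S.j_ne
  have hL := S.L_pos
  have hi' : (S.j i : ℝ) ≠ 0 := Int.cast_ne_zero.2 hi
  exact Finset.sum_pos' (fun _ _ => sq_nonneg _) ⟨i, Finset.mem_univ i, by positivity⟩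

theorem eps_pos : 0 < S.eps := div_pos S.kin_j_pos S.φ_pos

theorem kin_j_eq : S.kin S.j = S.φ * S.eps := (mul_div_cancel₀ _ S.φ_pos.ne').symm

theorem gap_sq : S.gap ^ 2 = S.eps ^ 2 + 2 * S.eps := by
  have := S.eps_pos
  exact Real.sq_sqrt (by positivity)

theorem gap_pos : 0 < S.gap := by
  have := S.eps_pos
  exact Real.sqrt_pos.2 (by positivity)

theorem eps_le_gap : S.eps ≤ S.gap := Real.le_sqrt_of_sq_le (by linarith [S.eps_pos])

theorem sqrt_eps_le_gap : √S.eps ≤ S.gap := Real.sqrt_le_sqrt (by nlinarith [S.eps_pos])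

theorem one_add_sub_gap_mul_add_gap : (1 + S.eps - S.gap) * (1 + S.eps + S.gap) = 1 := by
  linear_combination -S.gap_sq

theorem one_add_sub_gap_pos : 0 < 1 + S.eps - S.gap :=
  (pos_iff_pos_of_mul_pos (S.one_add_sub_gap_mul_add_gap ▸ one_pos)).2
    (by linarith [S.eps_pos, S.gap_pos])

theorem EBog_eq : S.EBog = -(S.φ * (1 + S.eps - S.gap)) := by
  have hsqrt : √(S.kin S.j ^ 2 + 2 * S.φ * S.kin S.j) = S.φ * S.gap := by
    rw [kin_j_eq, gap, ← Real.sqrt_sq S.φ_pos.le, ← Real.sqrt_mul (sq_nonneg _),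
      Real.sqrt_sq S.φ_pos.le]
    ring_nf
  rw [EBog, hsqrt, kin_j_eq]
  ring

theorem zMax_eq : S.zMax = S.EBog + S.φ * (√S.eps * S.gap) := by
  rw [zMax, gap]
  ring

theorem zMax_neg (hε : S.eps ≤ 1 / 100) : S.zMax < 0 := by
  have hhalf := half_le_sub_mul (Real.sqrt_nonneg _) S.eps_pos.le hε S.gap_sq
    (Real.sq_sqrt S.eps_pos.le).le
  have : 0 < S.φ * ((1 + S.eps - S.gap) - √S.eps * S.gap) :=
    mul_pos S.φ_pos (by linarith [S.eps_pos, S.gap_pos])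
  rw [zMax_eq, EBog_eq]
  linarith

theorem coupling_sq_le_pairs (n : Mode d →₀ ℕ) :
    S.coupling n ^ 2 ≤ (S.φ / S.N) ^ 2 * (n 0 * (n 0 - 1) * (S.pairs n / 2 + 1) ^ 2) := by
  have hzero : 0 ≤ (n 0 : ℝ) * (n 0 - 1) := by
    rcases Nat.eq_zero_or_pos (n 0) with h0 | h0
    · simp [h0]
    · exact mul_nonneg (Nat.cast_nonneg _) (sub_nonneg.2 (Nat.one_le_cast.2 h0))
  rw [coupling_sq, pairs]
  gcongr
  push_cast
  linarith [sq_nonneg ((n S.j : ℝ) - n (-S.j))]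

/-- For `z ≤ E^Bog + φ σ gap` it is a supersolution of the recursion of `S.schur z` on the
configurations with at least `2 σ` particles in the modes `±j`. -/
noncomputable def barrier (σ : ℝ) (n : Mode d →₀ ℕ) : ℝ :=
  S.φ * ((n 0 + 1) / S.N * ((S.pairs n / 2 - σ) * (1 + S.eps + S.gap)))

variable {S} {σ z : ℝ}

theorem barrier_pairUp_pos {n : Mode d →₀ ℕ} (hn : 2 * σ ≤ S.pairs n) :
    0 < S.barrier σ (S.pairUp n) := by
  have hε := S.eps_pos
  have hb := S.gap_pos
  have hN := S.N_cast_pos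
  have hp : 0 < (S.pairs (S.pairUp n) : ℝ) / 2 - σ := by
    rw [pairs_pairUp]
    push_cast
    linarith
  have := S.φ_pos
  rw [barrier]
  positivity

theorem coupling_sq_div_barrier_le {n : Mode d →₀ ℕ} (hn : 2 * σ ≤ S.pairs n) :
    S.coupling n ^ 2 / S.barrier σ (S.pairUp n) ≤
      S.φ * (n 0 / S.N * ((S.pairs n / 2 + 1) ^ 2 * (1 + S.eps - S.gap) /
        (S.pairs n / 2 + 1 - σ))) := by
  have hc := S.one_add_sub_gap_pos
  have hφ := S.φ_pos
  have hN := S.N_cast_pos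
  have hp : 0 < (S.pairs n : ℝ) / 2 + 1 - σ := by linarith
  rcases lt_or_ge (n 0) 2 with h0 | h0
  · rw [S.coupling_eq_zero h0, zero_pow two_ne_zero, zero_div]
    positivity
  · rw [div_le_iff₀ (barrier_pairUp_pos hn)]
    refine (S.coupling_sq_le_pairs n).trans_eq ?_
    have hup : ((n 0 - 2 : ℕ) : ℝ) + 1 = n 0 - 1 := by
      rw [Nat.cast_sub h0]
      push_cast
      ring
    have hpairs : ((S.pairs n + 2 : ℕ) : ℝ) / 2 - σ = S.pairs n / 2 + 1 - σ := by
      push_cast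
      ring
    rw [barrier, pairs_pairUp, pairUp_zero, hup, hpairs]
    generalize (S.pairs n : ℝ) / 2 = p at hp ⊢
    calc (S.φ / S.N) ^ 2 * (n 0 * (n 0 - 1) * (p + 1) ^ 2)
        = (S.φ / S.N) ^ 2 * (n 0 * (n 0 - 1) * (p + 1) ^ 2) *
            ((1 + S.eps - S.gap) * (1 + S.eps + S.gap)) := by
          rw [one_add_sub_gap_mul_add_gap, mul_one]
      _ = _ := by field_simp

theorem barrier_add_le (hε : S.eps ≤ 1 / 100) (hσ : 0 ≤ σ) (hσε : σ ^ 2 ≤ S.eps)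
    (hz : z ≤ S.EBog + S.φ * (σ * S.gap)) {n : Mode d →₀ ℕ} (hdeg : n.degree = S.N)
    (hn : 2 * σ ≤ S.pairs n) :
    S.barrier σ n + S.coupling n ^ 2 / S.barrier σ (S.pairUp n) ≤ S.diagEnergy n - z := by
  have hle : (S.pairs n : ℝ) + n 0 ≤ S.N := by
    exact_mod_cast hdeg ▸ S.pairs_add_zero_le_degree n
  have hscalar := mul_le_mul_of_nonneg_left (supersolution_inequality (p := S.pairs n / 2)
    (Nat.cast_nonneg (n 0)) S.N_cast_pos (by linarith) hσ (by linarith) S.eps_pos.le hε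
    S.gap_pos.le S.gap_sq hσε) S.φ_pos.le
  have hcoup := coupling_sq_div_barrier_le hn
  have hrest := S.restEnergy_nonneg n
  rw [EBog_eq] at hz
  rw [barrier, diagEnergy, pairEnergy, kin_j_eq]
  have : S.φ * (2 * (S.pairs n / 2) * (S.eps + n 0 / S.N) + (1 + S.eps - S.gap) - σ * S.gap) =
    (S.φ * S.eps + S.φ / S.N * n 0) * S.pairs n + S.φ * (1 + S.eps - S.gap) -
      S.φ * (σ * S.gap) := by ring
  linarith

theorem barrier_le_schur (hε : S.eps ≤ 1 / 100) (hσ : 0 ≤ σ) (hσε : σ ^ 2 ≤ S.eps)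
    (hz : z ≤ S.EBog + S.φ * (σ * S.gap)) {n : Mode d →₀ ℕ} (hdeg : n.degree = S.N)
    (hn : 2 * σ ≤ S.pairs n) : S.barrier σ n ≤ S.schur z n := by
  refine le_schur_of_supersolution (A := {n | n.degree = S.N ∧ 2 * σ ≤ S.pairs n})
    (fun m hm h0 => ⟨(S.degree_pairUp h0).trans hm.1, ?_⟩) (fun m hm _ => barrier_pairUp_pos hm.2)
    (fun m hm => barrier_add_le hε hσ hσε hz hm.1 hm.2) ⟨hdeg, hn⟩
  rw [pairs_pairUp]
  push_cast
  linarith [hm.2]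

theorem div_le_schur (hε : S.eps ≤ 1 / 100) (hz : z ≤ S.zMax) {n : Mode d →₀ ℕ}
    (hdeg : n.degree = S.N) (hn : 1 ≤ S.pairs n) : S.φ / S.N * (2 / 5) ≤ S.schur z n := by
  have hσ : √S.eps ≤ 1 / 10 := Real.sqrt_le_iff.2 ⟨by norm_num, by linarith⟩
  have hn' : (1 : ℝ) ≤ S.pairs n := by exact_mod_cast hn
  have hN := S.N_cast_pos
  have hφ := S.φ_pos
  have hεpos := S.eps_pos
  have hb := S.gap_pos
  calc S.φ / S.N * (2 / 5) = S.φ * ((0 + 1) / S.N * ((1 / 2 - 1 / 10) * (1 + 0 + 0))) := by ring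
    _ ≤ S.barrier (√S.eps) n := by
        rw [barrier]
        gcongr
        · positivity
        · linarith
    _ ≤ S.schur z n := barrier_le_schur hε (Real.sqrt_nonneg _) (Real.sq_sqrt hεpos.le).le
        (hz.trans_eq S.zMax_eq) hdeg (by linarith)

theorem schur_EBog_condensate_nonneg (hε : S.eps ≤ 1 / 100) : 0 ≤ S.schur S.EBog S.condensate := by
  have hzero : S.barrier 0 S.condensate = 0 := by simp [barrier, pairs_condensate]
  exact hzero ▸ barrier_le_schur hε le_rfl (by simpa using S.eps_pos.le) (by simp)
    (Finsupp.degree_single _ _) (by simp)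

end Barriers

variable {S}

section Monotonicity

variable {z z' : ℝ}

theorem schur_pairUp_pos (hε : S.eps ≤ 1 / 100) (hz : z ≤ S.zMax) {n : Mode d →₀ ℕ}
    (hdeg : n.degree = S.N) (h0 : 2 ≤ n 0) : 0 < S.schur z (S.pairUp n) := by
  have hφ := S.φ_pos
  have hN := S.N_cast_pos
  refine lt_of_lt_of_le (by positivity)
    (div_le_schur hε hz ((S.degree_pairUp h0).trans hdeg) ?_)
  rw [pairs_pairUp]
  omega

theorem schur_add_le_schur (hε : S.eps ≤ 1 / 100) (hzz' : z ≤ z') (hz' : z' ≤ S.zMax)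
    {n : Mode d →₀ ℕ} (hdeg : n.degree = S.N) : S.schur z' n + (z' - z) ≤ S.schur z n := by
  refine le_schur_of_supersolution (A := {n | n.degree = S.N})
    (u := fun n => S.schur z' n + (z' - z)) (fun m hm h0 => (S.degree_pairUp h0).trans hm)
    (fun m hm h0 => ?_) (fun m hm => ?_) hdeg
  · linarith [schur_pairUp_pos hε hz' hm h0]
  · have hle : S.coupling m ^ 2 / (S.schur z' (S.pairUp m) + (z' - z)) ≤ S.selfEnergy z' m := by
      rw [selfEnergy]
      rcases lt_or_ge (m 0) 2 with h0 | h0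
      · simp [S.coupling_eq_zero h0]
      · have := schur_pairUp_pos hε hz' hm h0
        gcongr
        linarith
    rw [S.schur_eq z' m]
    linarith

theorem strictAntiOn_schur (hε : S.eps ≤ 1 / 100) {n : Mode d →₀ ℕ} (hdeg : n.degree = S.N) :
    StrictAntiOn (fun z => S.schur z n) (Set.Iic S.zMax) := fun z _ z' hz' hzz' => by
  linarith [schur_add_le_schur hε hzz'.le hz' hdeg]

theorem continuousOn_schur (hε : S.eps ≤ 1 / 100) {n : Mode d →₀ ℕ} (hdeg : n.degree = S.N) :
    ContinuousOn (fun z => S.schur z n) (Set.Iic S.zMax) := by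
  induction n using S.pairUp_induction with
  | base n h0 =>
    simp only [schur_of_zero_lt_two, h0]
    fun_prop
  | step n h0 ih =>
    have hself : ContinuousOn (fun z => S.selfEnergy z n) (Set.Iic S.zMax) :=
      continuousOn_const.div (ih ((S.degree_pairUp h0).trans hdeg))
        fun z hz => (schur_pairUp_pos hε hz hdeg h0).ne'
    exact ((continuousOn_const.sub continuousOn_id).sub hself).congr fun z _ => S.schur_eq z n

end Monotonicity

section UpperBound

variable (S) in
/-- An upper bound, in units of `φ`, for the distance from the Bogoliubov energy to `S.zStar`. -/
noncomputable def shift : ℝ := 2 / S.N + 3 * (1 + S.eps - S.gap) / (S.N * S.gap)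

variable (S) in
/-- At `z = E^Bog + φ shift` it is a subsolution of the recursion of `S.schur z` on the pair states
with `N` particles. -/
noncomputable def upperBarrier (n : Mode d →₀ ℕ) : ℝ :=
  S.φ * ((1 + 3 / (S.N * S.gap)) * (S.pairs n / 2) * (1 + S.eps + S.gap))

theorem coupling_sq_div_upperBarrier {n : Mode d →₀ ℕ} (hn : S.IsPairState n) :
    S.coupling n ^ 2 / S.upperBarrier (S.pairUp n) =
      S.φ * (n 0 * (n 0 - 1) / S.N ^ 2 / (1 + 3 / (S.N * S.gap)) *
        ((S.pairs n / 2 + 1) * (1 + S.eps - S.gap))) := by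
  have hφ := S.φ_pos
  have hN := S.N_cast_pos
  have hb := S.gap_pos
  have hε := S.eps_pos
  have hκ : 0 < 1 + 3 / (S.N * S.gap) := by positivity
  have hj : (n S.j : ℝ) + 1 = S.pairs n / 2 + 1 := by
    rw [pairs, ← hn.1]
    push_cast
    ring
  have hup : ((S.pairs n + 2 : ℕ) : ℝ) / 2 = S.pairs n / 2 + 1 := by
    push_cast
    ring
  have hp : 0 < (S.pairs n : ℝ) / 2 + 1 := by positivity
  rw [coupling_sq, ← hn.1, hj, upperBarrier, pairs_pairUp, hup]
  generalize (S.pairs n : ℝ) / 2 + 1 = p at hp ⊢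
  generalize 1 + 3 / (S.N * S.gap) = κ at hκ ⊢
  rw [div_eq_iff (by positivity)]
  calc (S.φ / S.N) ^ 2 * ((n 0 : ℝ) * (n 0 - 1) * (p * p))
      = (S.φ / S.N) ^ 2 * (n 0 * (n 0 - 1) * (p * p)) *
          ((1 + S.eps - S.gap) * (1 + S.eps + S.gap)) := by
        rw [one_add_sub_gap_mul_add_gap, mul_one]
    _ = _ := by field_simp

theorem le_upperBarrier_add {n : Mode d →₀ ℕ} (hn : S.IsPairState n) (hdeg : n.degree = S.N) :
    S.diagEnergy n - (S.EBog + S.φ * S.shift) ≤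
      S.upperBarrier n + S.coupling n ^ 2 / S.upperBarrier (S.pairUp n) := by
  have hN := S.N_cast_pos
  have hb := S.gap_pos
  have hc := S.one_add_sub_gap_pos
  have hzero : (n 0 : ℝ) = S.N - 2 * (S.pairs n / 2) := by
    rw [← hdeg, ← hn.pairs_add_zero]
    push_cast
    ring
  have hscalar := subsolution_inequality (p := S.pairs n / 2) hb hN (by positivity) S.eps_le_gap
  rw [← hzero, ← shift] at hscalar
  have hratio := two_mul_sub_le_div (κ := 1 + 3 / (S.N * S.gap)) (by positivity) hN (n 0)
  rw [coupling_sq_div_upperBarrier hn, upperBarrier, hn.diagEnergy_eq, pairEnergy, kin_j_eq,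
    EBog_eq]
  calc (S.φ * S.eps + S.φ / S.N * n 0) * S.pairs n -
        (-(S.φ * (1 + S.eps - S.gap)) + S.φ * S.shift)
      = S.φ * (2 * (S.pairs n / 2) * (S.eps + n 0 / S.N) + (1 + S.eps - S.gap) - S.shift) := by
        ring
    _ ≤ S.φ * ((1 + 3 / (S.N * S.gap)) * (S.pairs n / 2) * (1 + S.eps + S.gap) +
          (2 * (n 0 - 1) / S.N - (1 + 3 / (S.N * S.gap))) *
            ((S.pairs n / 2 + 1) * (1 + S.eps - S.gap))) :=
        mul_le_mul_of_nonneg_left hscalar S.φ_pos.le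
    _ ≤ S.φ * ((1 + 3 / (S.N * S.gap)) * (S.pairs n / 2) * (1 + S.eps + S.gap) +
          n 0 * (n 0 - 1) / S.N ^ 2 / (1 + 3 / (S.N * S.gap)) *
            ((S.pairs n / 2 + 1) * (1 + S.eps - S.gap))) := by
        have := S.φ_pos
        gcongr
    _ = _ := mul_add _ _ _

theorem schur_EBog_add_shift_condensate_nonpos (hε : S.eps ≤ 1 / 100)
    (hshift : S.EBog + S.φ * S.shift ≤ S.zMax) :
    S.schur (S.EBog + S.φ * S.shift) S.condensate ≤ 0 := by
  have hzero : S.upperBarrier S.condensate = 0 := by simp [upperBarrier, pairs_condensate]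
  exact hzero ▸ schur_le_of_subsolution (A := {n | S.IsPairState n ∧ n.degree = S.N})
    (fun m hm h0 => ⟨hm.1.pairUp, (S.degree_pairUp h0).trans hm.2⟩)
    (fun m hm h0 => schur_pairUp_pos hε hshift hm.2 h0)
    (fun m hm => le_upperBarrier_add hm.1 hm.2)
    ⟨S.isPairState_condensate, Finsupp.degree_single _ _⟩

theorem shift_le (hε : S.eps ≤ 1 / 100) : S.shift ≤ 5 / (S.N * √S.eps) := by
  have hN := S.N_cast_pos
  have := S.one_add_sub_gap_pos
  have hσ : 0 < √S.eps := Real.sqrt_pos.2 S.eps_pos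
  have hσ1 : √S.eps ≤ 1 := Real.sqrt_le_one.2 (by linarith)
  calc S.shift ≤ 2 / (S.N * √S.eps) + 3 * 1 / (S.N * √S.eps) := by
        rw [shift]
        gcongr
        · exact mul_le_of_le_one_right hN.le hσ1
        · linarith [S.eps_le_gap]
        · exact S.sqrt_eps_le_gap
    _ = 5 / (S.N * √S.eps) := by ring

theorem shift_nonneg : 0 ≤ S.shift := by
  have hb := S.gap_pos
  have hc := S.one_add_sub_gap_pos
  rw [shift]
  positivity

theorem EBog_add_shift_le_zMax (hε : S.eps ≤ 1 / 100) (hN : 5 ≤ S.N * (S.eps * √S.eps)) :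
    S.EBog + S.φ * S.shift ≤ S.zMax := by
  have hσ : 0 < √S.eps := Real.sqrt_pos.2 S.eps_pos
  have hshift : S.shift ≤ √S.eps * S.gap :=
    calc S.shift ≤ 5 / (S.N * √S.eps) := shift_le hε
      _ ≤ √S.eps * √S.eps := by
          rw [div_le_iff₀ (mul_pos S.N_cast_pos hσ), Real.mul_self_sqrt S.eps_pos.le]
          linarith
      _ ≤ √S.eps * S.gap := by
          gcongr
          exact S.sqrt_eps_le_gap
  rw [zMax_eq]
  gcongr
  exact S.φ_pos.le

end UpperBound

section FixedPoint

theorem flowDefined_of_le_zMax (hε : S.eps ≤ 1 / 100) {z : ℝ} (hz : z ≤ S.zMax) :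
    S.FlowDefined z :=
  flowDefined (hz.trans_lt (zMax_neg S hε))
    (mul_pos (div_pos S.φ_pos S.N_cast_pos) (by norm_num)) fun _ => div_le_schur hε hz

theorem eqOn_f_schur (hε : S.eps ≤ 1 / 100) :
    Set.EqOn S.f (fun z => S.schur z S.condensate) (Set.Iic S.zMax) := fun _ hz =>
  f_eq_schur (lt_of_le_of_lt hz (zMax_neg S hε))
    (mul_pos (div_pos S.φ_pos S.N_cast_pos) (by norm_num)) fun _ => div_le_schur hε hz

theorem strictAntiOn_f (hε : S.eps ≤ 1 / 100) : StrictAntiOn S.f (Set.Iic S.zMax) :=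
  (strictAntiOn_schur hε (Finsupp.degree_single _ _)).congr (eqOn_f_schur hε).symm

theorem continuousOn_f (hε : S.eps ≤ 1 / 100) : ContinuousOn S.f (Set.Iic S.zMax) :=
  (continuousOn_schur hε (Finsupp.degree_single _ _)).congr (eqOn_f_schur hε)

theorem exists_isFixedPoint_mem_Icc (hε : S.eps ≤ 1 / 100) (hN : 5 ≤ S.N * (S.eps * √S.eps)) :
    ∃ z ∈ Set.Icc S.EBog (S.EBog + S.φ * S.shift), S.IsFixedPoint z := by
  have hle : S.EBog ≤ S.EBog + S.φ * S.shift :=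
    le_add_of_nonneg_right (mul_nonneg S.φ_pos.le shift_nonneg)
  have hmax := EBog_add_shift_le_zMax hε hN
  have hlow : 0 ≤ S.f S.EBog :=
    (schur_EBog_condensate_nonneg hε).trans_eq (eqOn_f_schur hε (hle.trans hmax)).symm
  have hupp : S.f (S.EBog + S.φ * S.shift) ≤ 0 :=
    (eqOn_f_schur hε hmax).trans_le (schur_EBog_add_shift_condensate_nonpos hε hmax)
  obtain ⟨z, hz, hroot⟩ := intermediate_value_Icc' hle
    ((continuousOn_f hε).mono fun _ h => h.2.trans hmax) ⟨hupp, hlow⟩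
  exact ⟨z, hz, hz.2.trans hmax, hroot⟩

theorem IsFixedPoint.eq {z z' : ℝ} (hz : S.IsFixedPoint z) (hz' : S.IsFixedPoint z')
    (hε : S.eps ≤ 1 / 100) : z = z' :=
  (strictAntiOn_f hε).injOn hz.1 hz'.1 (hz.2.trans hz'.2.symm)

end FixedPoint

end ThreeModeSystem

open ThreeModeSystem in
theorem mainTheorem4_general {d : ℕ} (S : ThreeModeSystem d) (hε : S.eps ≤ 1 / 100)
    (hN : 5 ≤ S.N * (S.eps * √S.eps)) :
    S.HasFixedPoint ∧ S.zStar ∈ Set.Icc S.EBog (S.EBog + 5 * S.φ / (S.N * √S.eps)) := by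
  obtain ⟨z, hz, hfix⟩ := exists_isFixedPoint_mem_Icc hε hN
  have hzStar : S.IsFixedPoint S.zStar := Classical.epsilon_spec ⟨z, hfix⟩
  refine ⟨⟨fun _ => flowDefined_of_le_zMax hε, z, hfix, fun _ h => h.eq hfix hε⟩, ?_⟩
  rw [hzStar.eq hfix hε, mul_comm 5, mul_div_assoc]
  refine ⟨hz.1, hz.2.trans ?_⟩
  have := S.φ_pos
  gcongr
  exact shift_le hε

namespace ThreeModeSystem

section Regimes

variable {d : ℕ}

theorem GammaCondition.one_le {S : ThreeModeSystem d} {γ κ : ℝ} (h : S.GammaCondition γ κ) :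
    1 ≤ κ * (S.N * (S.eps * √S.eps)) := by
  have hε := S.eps_pos
  have hN := S.N_cast_pos
  have hle : 1 / (S.N : ℝ) ≤ κ * (S.eps * √S.eps) := by
    have : 0 ≤ S.eps ^ 2 + S.eps / (S.N : ℝ) ^ γ := by positivity
    linarith [h.1]
  rw [div_le_iff₀ hN] at hle
  linarith

theorem abs_zStar_sub_EBog_le {S : ThreeModeSystem d} (hε : S.eps ≤ 1 / 100)
    (hN : 5 ≤ S.N * (S.eps * √S.eps)) {β : ℝ} (hβ : β ≤ 1) :
    |S.zStar - S.EBog| ≤ 5 * S.φ * (1 / (S.eps * (S.N : ℝ) ^ β)) := by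
  obtain ⟨hlow, hupp⟩ := (mainTheorem4_general S hε hN).2
  have hεpos := S.eps_pos
  have hNpos := S.N_cast_pos
  have hφ := S.φ_pos
  have hεσ : S.eps ≤ √S.eps := Real.le_sqrt_of_sq_le (by nlinarith)
  have hpow : (S.N : ℝ) ^ β ≤ S.N :=
    Real.rpow_le_self_of_one_le (by exact_mod_cast S.N_pos) hβ
  rw [abs_of_nonneg (sub_nonneg.2 hlow), mul_one_div]
  calc S.zStar - S.EBog ≤ 5 * S.φ / (√S.eps * S.N) := by
        rw [mul_comm (√S.eps)]
        linarith
    _ ≤ 5 * S.φ / (S.eps * (S.N : ℝ) ^ β) := by gcongr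

theorem tendsto_zStar_sub_EBog {ι : Type*} {l : Filter ι} {S : ι → ThreeModeSystem d} {φ₀ : ℝ}
    (hφ : ∀ i, (S i).φ ≤ φ₀) (hε : ∀ᶠ i in l, (S i).eps ≤ 1 / 100)
    (hN : Tendsto (fun i => (S i).N * ((S i).eps * √(S i).eps)) l atTop) :
    (∀ᶠ i in l, (S i).HasFixedPoint) ∧ Tendsto (fun i => (S i).zStar - (S i).EBog) l (𝓝 0) := by
  have hN5 := hN.eventually_ge_atTop 5
  refine ⟨?_, squeeze_zero_norm' ?_ (hN.const_div_atTop (5 * φ₀))⟩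
  · filter_upwards [hε, hN5] with i hi hi5 using (mainTheorem4_general _ hi hi5).1
  · filter_upwards [hε, hN5] with i hi hi5
    have hεpos := (S i).eps_pos
    have hNpos := (S i).N_cast_pos
    obtain ⟨hlow, hupp⟩ := (mainTheorem4_general _ hi hi5).2
    rw [Real.norm_of_nonneg (sub_nonneg.2 hlow), sub_le_iff_le_add']
    refine hupp.trans ?_
    gcongr
    · linarith [(S i).φ_pos, hφ i]
    · exact hφ i
    · exact mul_le_of_le_one_left (Real.sqrt_nonneg _) (by linarith)

theorem meanField_limit {ι : Type*} {l : Filter ι} (S : ι → ThreeModeSystem d)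
    (S₀ : ThreeModeSystem d)
    (hS : ∀ i, (S i).L = S₀.L ∧ (S i).j = S₀.j ∧ (S i).φ = S₀.φ) (hε : S₀.eps ≤ 1 / 100)
    (hN : Tendsto (fun i => (S i).N) l atTop) :
    (∀ᶠ i in l, (S i).HasFixedPoint) ∧ Tendsto (fun i => (S i).zStar) l (𝓝 S₀.EBog) := by
  have hkin (i : ι) : (S i).kin (S i).j = S₀.kin S₀.j := by simp only [kin, hS]
  have heps (i : ι) : (S i).eps = S₀.eps := by rw [eps, eps, hkin, (hS i).2.2]
  have hEBog (i : ι) : (S i).EBog = S₀.EBog := by rw [EBog, EBog, hkin, (hS i).2.2]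
  have hpos : 0 < S₀.eps * √S₀.eps := mul_pos S₀.eps_pos (Real.sqrt_pos.2 S₀.eps_pos)
  obtain ⟨hfix, hlim⟩ := tendsto_zStar_sub_EBog (S := S) (fun i => (hS i).2.2.le)
    (Eventually.of_forall fun i => (heps i).trans_le hε)
    (by simpa only [heps, Function.comp_def] using
      (tendsto_natCast_atTop_atTop.comp hN).atTop_mul_const hpos)
  exact ⟨hfix, by simpa [hEBog] using hlim.add_const S₀.EBog⟩

theorem eps_eq_div (S : ThreeModeSystem d) :
    S.eps = (∑ i, (2 * Real.pi * S.j i) ^ 2) / S.φ / S.L ^ 2 := by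
  have hkin : S.kin S.j = (∑ i, (2 * Real.pi * S.j i) ^ 2) / S.L ^ 2 := by
    simp only [kin, Finset.sum_div, ← div_pow, mul_div_right_comm]
  rw [eps, hkin, div_right_comm]

theorem N_eq_density_mul (S : ThreeModeSystem d) : (S.N : ℝ) = S.density * S.L ^ d :=
  (div_mul_cancel₀ _ (pow_pos S.L_pos d).ne').symm

theorem fixedDensity_limit (hd : 4 ≤ d) (ρ φ₀ : ℝ) (j₀ : Fin d → ℤ) (S : ℕ → ThreeModeSystem d)
    (hS : ∀ n, (S n).density = ρ ∧ (S n).j = j₀ ∧ (S n).φ = φ₀)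
    (hL : Tendsto (fun n => (S n).L) atTop atTop) :
    (∀ᶠ n in atTop, (S n).HasFixedPoint) ∧
      Tendsto (fun n => (S n).zStar - (S n).EBog) atTop (𝓝 0) := by
  set a : ℝ := (∑ i, (2 * Real.pi * j₀ i) ^ 2) / φ₀
  have heps (n : ℕ) : (S n).eps = a / (S n).L ^ 2 := by
    rw [eps_eq_div, (hS n).2.1, (hS n).2.2]
  have ha : 0 < a := by
    have := (S 0).eps_pos
    rwa [heps, div_pos_iff_of_pos_right (pow_pos (S 0).L_pos 2)] at this
  have hρ : 0 < ρ := by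
    rw [← (hS 0).1]
    exact div_pos (S 0).N_cast_pos (pow_pos (S 0).L_pos d)
  have hN (n : ℕ) : ρ * (a * √a) * (S n).L ^ (d - 3) = (S n).N * ((S n).eps * √(S n).eps) := by
    have hLpos := (S n).L_pos
    rw [N_eq_density_mul, (hS n).1, heps, Real.sqrt_div ha.le, Real.sqrt_sq hLpos.le,
      ← pow_sub_mul_pow _ (by omega : 3 ≤ d)]
    field_simp
  refine tendsto_zStar_sub_EBog (fun n => (hS n).2.2.le) ?_ ?_
  · simp only [heps]
    exact (((tendsto_pow_atTop two_ne_zero).comp hL).const_div_atTop a).eventually_le_const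
      (by norm_num)
  · refine Tendsto.congr hN (Tendsto.const_mul_atTop (by positivity) ?_)
    exact (tendsto_pow_atTop (by omega)).comp hL

end Regimes

end ThreeModeSystem

theorem mainTheorem4 :
    (∃ c > (0 : ℝ), ∃ C > (0 : ℝ), ∀ γ : ℝ, 0 < γ → γ < 1 →
      ∃ ε₀ > (0 : ℝ), ∃ kγ > (0 : ℝ),
        (∀ (d : ℕ) (S : ThreeModeSystem d), S.eps ≤ ε₀ → S.GammaCondition γ kγ →
          S.HasFixedPoint) ∧
        ∀ β : ℝ, 0 < β → β < 1 → ∃ τ > (0 : ℝ),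
          ∀ (d : ℕ) (S : ThreeModeSystem d), S.eps ≤ ε₀ → S.GammaCondition γ kγ →
            1 / (S.N : ℝ) ^ β ≤ τ * S.eps →
            1 / (S.N : ℝ) ^ (1 - β) ≤ τ * Real.sqrt S.eps →
            |S.zStar - S.EBog| ≤ C * S.φ *
              (1 / (S.eps * (S.N : ℝ) ^ β) +
                1 / Real.sqrt S.eps *
                  (1 / (1 + c * Real.sqrt S.eps)) ^ ((S.N : ℝ) ^ (1 - β)) +
                1 / (S.N : ℝ))) ∧
    (∃ ε₀ > (0 : ℝ), ∀ (d : ℕ) (S : ℕ → ThreeModeSystem d) (S₀ : ThreeModeSystem d),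
      (∀ n, (S n).L = S₀.L ∧ (S n).j = S₀.j ∧ (S n).φ = S₀.φ) → S₀.eps ≤ ε₀ →
      Tendsto (fun n => (S n).N) atTop atTop →
      (∀ᶠ n in atTop, (S n).HasFixedPoint) ∧
        Tendsto (fun n => (S n).zStar) atTop (𝓝 S₀.EBog)) ∧
    (∀ d : ℕ, 4 ≤ d → ∀ (ρ φ₀ : ℝ) (j₀ : Fin d → ℤ) (S : ℕ → ThreeModeSystem d),
      (∀ n, (S n).density = ρ ∧ (S n).j = j₀ ∧ (S n).φ = φ₀) →
      Tendsto (fun n => (S n).L) atTop atTop →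
      (∀ᶠ n in atTop, (S n).HasFixedPoint) ∧
        Tendsto (fun n => (S n).zStar - (S n).EBog) atTop (𝓝 0)) := by
  refine ⟨⟨1, one_pos, 5, by norm_num, fun γ _ _ => ⟨1 / 100, by norm_num, 1 / 5, by norm_num,
    fun d S hε hγ => (mainTheorem4_general S hε (by linarith [hγ.one_le])).1, fun β _ hβ =>
    ⟨1, one_pos, fun d S hε hγ _ _ => ?_⟩⟩⟩,
    ⟨1 / 100, by norm_num, fun d => ThreeModeSystem.meanField_limit⟩,
    fun d hd => ThreeModeSystem.fixedDensity_limit hd⟩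
  have := S.φ_pos
  refine (ThreeModeSystem.abs_zStar_sub_EBog_le hε (by linarith [hγ.one_le]) hβ.le).trans ?_
  rw [add_assoc]
  gcongr
  exact le_add_of_nonneg_right (by positivity)
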